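/- Let $V$ be a finite-dimensional complex vector space, $G\subset GL(V)$ a finite subgroup, and $B=S(V)$ the symmetric algebra, graded with $V$ in degree $1$. Let $D_B\subset \mathrm{End}_{\mathbb C}(B)$ be the algebra of differential operators on $B$, i.e. the Weyl algebra generated by the multiplications by elements $v\in V$ and the constant derivations $\partial_\varphi$, $\varphi\in V^*$. The group $G$ acts on $B$ by algebra automorphisms and on $D_B$ by $P\mapsto gPg^{-1}$; put $D=D_B^G$. Let $\nabla\in D$ be the Euler operator, the derivation of $B$ with $\nabla v=v$ for $v\in V$, and for $n\in\mathbb Z$ let $D(n)=\{P\in D: [\nabla,P]=nP\}$, $D^0=D(0)$, $D^-=\bigoplus_{n<0}D(n)$. Let $DD^-$ be the left ideal of $D$ generated by $D^-$, and put $$R=D^0/(D^0\cap DD^-).$$ For a $D$-submodule $N\subset B$ put $N^{ann}=\{n\in N : D^-n=0\}$; the action of $D^0$ makes $B^{ann}$ an $R$-module and each $N^{ann}$ an $R$-submodule of $B^{ann}$. Then: 1. $B^{ann}$ is a finite-dimensional (over $\mathbb C$) semisimple $R$-module. 2. Let $\mathrm{Mod}_D(B)$ be the category whose objects are the $D$-submodules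 of $B$ and whose morphisms are all $D$-linear maps between them, and let $\mathrm{Mod}_R(B^{ann})$ be the category whose objects are the $R$-submodules of $B^{ann}$ and whose morphisms are all $R$-linear maps between them. The functor $N\mapsto N^{ann}$, $f\mapsto f|_{N^{ann}}$, from $\mathrm{Mod}_D(B)$ to $\mathrm{Mod}_R(B^{ann})$ is an isomorphism of categories, and its inverse is given on objects by $W\mapsto DW$, the $D$-submodule of $B$ generated by $W$. 3. A $D$-submodule $N\subset B$ is simple if and only if the $R$-module $N^{ann}$ is simple; and an $R$-submodule $W\subset B^{ann}$ is simple if and only if the $D$-module $DW$ is simple. 4. Every simple $R$-submodule of $B^{ann}$ is contained in a single homogeneous component of $B$. -/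

import Mathlib

set_option maxSynthPendingDepth 3

open CategoryTheory

noncomputable section

namespace InvDiff

universe u

section Abstract

variable {D : Type u} [Ring D] [Algebra ℂ D] (nab : D)

/-- The homogeneous component `D(n) = {P ∈ D | [∇, P] = nP}`, `n ∈ ℤ`, of a `ℂ`-algebra `D` with
respect to the adjoint action of an element `∇ ∈ D`. -/
def degPart (n : ℤ) : Submodule ℂ D where
  carrier := {P | nab * P - P * nab = n • P}
  add_mem' := by
    intro P Q hP hQ
    simp only [Set.mem_ofPred_eq] at *
    rw [smul_add, ← hP, ← hQ, mul_add, add_mul]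
    abel
  zero_mem' := by simp
  smul_mem' := by
    intro c P hP
    simp only [Set.mem_ofPred_eq] at *
    rw [smul_comm, ← hP, mul_smul_comm, smul_mul_assoc, smul_sub]

theorem mul_mem_degPart {m n : ℤ} {P Q : D} (hP : P ∈ degPart nab m) (hQ : Q ∈ degPart nab n) :
    P * Q ∈ degPart nab (m + n) := by
  change nab * _ - _ * nab = _ at hP hQ
  change nab * (P * Q) - (P * Q) * nab = (m + n) • (P * Q)
  rw [add_smul, ← smul_mul_assoc m, ← mul_smul_comm n, ← hP, ← hQ]
  noncomm_ring

/-- The subalgebra `D⁰ = D(0)`. -/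
def D0 : Subalgebra ℂ D where
  carrier := degPart nab 0
  mul_mem' := fun hP hQ => by simpa using mul_mem_degPart nab hP hQ
  add_mem' := fun hP hQ => (degPart nab 0).add_mem hP hQ
  algebraMap_mem' := by
    intro c
    change nab * algebraMap ℂ _ c - algebraMap ℂ _ c * nab = (0 : ℤ) • algebraMap ℂ _ c
    rw [Algebra.commutes c nab]
    simp

/-- The space `D⁻ = ⨁_{n < 0} D(n)`. -/
def Dneg : Submodule ℂ D := ⨆ n : {n : ℤ // n < 0}, degPart nab n

theorem mul_mem_Dneg {P Q : D} (hP : P ∈ Dneg nab) (hQ : Q ∈ D0 nab) : P * Q ∈ Dneg nab := by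
  refine Submodule.iSup_induction (motive := fun P => P * Q ∈ Dneg nab) _ hP ?_ ?_ ?_
  · intro n x hx
    refine Submodule.mem_iSup_of_mem n ?_
    have := mul_mem_degPart nab hx (show Q ∈ degPart nab 0 from hQ)
    simpa using this
  · simp
  · intro x y hx hy
    rw [add_mul]
    exact add_mem hx hy

/-- The left ideal `D D⁻` of `D`. -/
def DDneg : Ideal D := Ideal.span (Dneg nab : Set D)

/-- The ideal `D⁰ ∩ (D D⁻)` of `D⁰`. -/
def relIdeal : Ideal (D0 nab) := (DDneg nab).comap (D0 nab).val.toRingHom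

instance : (relIdeal nab).IsTwoSided where
  mul_mem_of_left := by
    rintro a b ha
    change ((a : D) * (b : D)) ∈ Ideal.span _
    change (a : D) ∈ Ideal.span _ at ha
    refine Submodule.span_induction
      (p := fun x _ => x * (b : D) ∈ Ideal.span (Dneg nab : Set D)) ?_ ?_ ?_ ?_ ha
    · intro x hx
      exact Ideal.subset_span (mul_mem_Dneg nab hx b.2)
    · simp
    · intro x y _ _ hx hy
      rw [add_mul]
      exact add_mem hx hy
    · intro c x _ hx
      rw [smul_eq_mul, mul_assoc]
      exact Ideal.mul_mem_left _ _ hx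

/-- The ring `R = D⁰ / (D⁰ ∩ D D⁻)`. -/
abbrev R : Type u := D0 nab ⧸ relIdeal nab

variable (M : Type u) [AddCommGroup M] [Module D M]

/-- The lowest weight space `M^ann = Ann_{D⁻}(M) = {m ∈ M | D⁻ m = 0}` of a `D`-module `M`, as a
`D⁰`-submodule of `M`. -/
def Mann : Submodule (D0 nab) M where
  carrier := {m | ∀ P ∈ Dneg nab, P • m = 0}
  add_mem' := by
    intro a b ha hb P hP
    rw [smul_add, ha P hP, hb P hP, add_zero]
  zero_mem' := by
    intro P _
    exact smul_zero P
  smul_mem' := by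
    intro Q b hb P hP
    change P • ((Q : D) • b) = 0
    rw [← mul_smul]
    exact hb _ (mul_mem_Dneg nab hP Q.2)

variable {M}

instance [Module ℂ M] [IsScalarTower ℂ D M] : Module ℂ (Mann nab M) := inferInstance

theorem DDneg_smul {P : D} (hP : P ∈ DDneg nab) (b : Mann nab M) : P • (b : M) = 0 := by
  refine Submodule.span_induction (p := fun x _ => x • (b : M) = 0) ?_ ?_ ?_ ?_ hP
  · intro x hx
    exact b.2 x hx
  · exact zero_smul _ _
  · intro x y _ _ hx hy
    rw [add_smul, hx, hy, add_zero]
  · intro c x _ hx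
    rw [smul_eq_mul, mul_smul, hx, smul_zero]

theorem Mann_isTorsion : Module.IsTorsionBySet (D0 nab) (Mann nab M) (relIdeal nab) := by
  rintro b ⟨a, ha⟩
  apply Subtype.ext
  exact DDneg_smul nab (P := (a : D)) ha b

/-- The `R`-module structure on `M^ann` induced by the action of `D⁰`. -/
instance : Module (R nab) (Mann nab M) := (Mann_isTorsion nab).module

theorem mk_smul (a : D0 nab) (b : Mann nab M) :
    ((Ideal.Quotient.mk (relIdeal nab) a • b : Mann nab M) : M) = (a : D) • (b : M) := rfl

/-- For a `D`-submodule `N` of `M`, the `R`-submodule `N^ann = Ann_{D⁻}(N) = N ∩ M^ann` of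
`M^ann`. -/
def ann (N : Submodule D M) : Submodule (R nab) (Mann nab M) where
  carrier := {b | (b : M) ∈ N}
  add_mem' := fun ha hb => N.add_mem ha hb
  zero_mem' := N.zero_mem
  smul_mem' := by
    intro r b hb
    obtain ⟨a, rfl⟩ := Ideal.Quotient.mk_surjective r
    change _ ∈ N
    rw [mk_smul]
    exact N.smul_mem _ hb

/-- For an `R`-submodule `W` of `M^ann`, the `D`-submodule `D W` of `M`. -/
def gen (W : Submodule (R nab) (Mann nab M)) : Submodule D M :=
  Submodule.span D ((fun b : Mann nab M => (b : M)) '' (W : Set (Mann nab M)))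

/-- Restriction of a `D`-linear map `N₁ → N₂` to an `R`-linear map `N₁^ann → N₂^ann`. -/
def annMap {N₁ N₂ : Submodule D M} (f : N₁ →ₗ[D] N₂) :
    ann nab N₁ →ₗ[R nab] ann nab N₂ where
  toFun x := ⟨⟨(f ⟨((x : Mann nab M) : M), x.2⟩ : M), by
      intro P hP
      have h0 : P • (⟨((x : Mann nab M) : M), x.2⟩ : N₁) = 0 := Subtype.ext (x.1.2 P hP)
      have := congrArg (fun y : N₂ => (y : M)) (f.map_smul P ⟨((x : Mann nab M) : M), x.2⟩)
      rw [h0, map_zero] at this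
      exact this.symm⟩, (f ⟨((x : Mann nab M) : M), x.2⟩).2⟩
  map_add' x y := by
    apply Subtype.ext
    apply Subtype.ext
    exact congrArg (fun y : N₂ => (y : M))
      (f.map_add ⟨((x : Mann nab M) : M), x.2⟩ ⟨((y : Mann nab M) : M), y.2⟩)
  map_smul' r x := by
    obtain ⟨a, rfl⟩ := Ideal.Quotient.mk_surjective r
    apply Subtype.ext
    apply Subtype.ext
    exact congrArg (fun y : N₂ => (y : M))
      (f.map_smul (a : D) ⟨((x : Mann nab M) : M), x.2⟩)

/-- The category `Mod_S(M)`: its objects are all `S`-submodules of the `S`-module `M`, and its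
morphisms are all `S`-linear maps between these modules. -/
abbrev ModSub (S : Type u) [Ring S] (M : Type u) [AddCommGroup M] [Module S M] : Type u :=
  InducedCategory (ModuleCat.{u} S) (fun N : Submodule S M => ModuleCat.of S N)

variable (M)

/-- The functor `N ↦ N^ann` from `D`-submodules of `M` to `R`-submodules of `M^ann`; on morphisms it
is the restriction of maps. -/
def annFunctor : ModSub D M ⥤ ModSub (R nab) (Mann nab M) where
  obj N := ann nab N
  map f := InducedCategory.homMk (ModuleCat.ofHom (annMap nab f.hom.hom))

end Abstract

section Polynomials

variable (V : Type u) [AddCommGroup V] [Module ℂ V]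

/-- The graded polynomial algebra `B = S(V)`, with `V` in degree `1`. -/
abbrev Poly : Type u := SymmetricAlgebra ℂ V

/-- The homogeneous component of degree `d` of `S(V)`: the span of the products of `d` vectors. -/
def polyDegree (d : ℕ) : Submodule ℂ (Poly V) :=
  (LinearMap.range (SymmetricAlgebra.ι ℂ V)) ^ d

variable {V}

/-- Auxiliary algebra map `b ↦ b + ε ∂(b)` into the dual numbers over `S(V)`, where `∂` extends the
given linear map `f : V → S(V)`. -/
def dualLift (f : V →ₗ[ℂ] Poly V) : Poly V →ₐ[ℂ] TrivSqZeroExt (Poly V) (Poly V) :=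
  SymmetricAlgebra.lift
    ((TrivSqZeroExt.inlAlgHom ℂ (Poly V) (Poly V)).toLinearMap ∘ₗ SymmetricAlgebra.ι ℂ V +
      ((TrivSqZeroExt.inrHom (Poly V) (Poly V)).restrictScalars ℂ) ∘ₗ f)

theorem dualLift_ι (f : V →ₗ[ℂ] Poly V) (v : V) :
    dualLift f (SymmetricAlgebra.ι ℂ V v) =
      TrivSqZeroExt.inl (SymmetricAlgebra.ι ℂ V v) + TrivSqZeroExt.inr (f v) := by
  simp [dualLift]

theorem dualLift_fst (f : V →ₗ[ℂ] Poly V) (b : Poly V) : (dualLift f b).fst = b := by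
  have h : (TrivSqZeroExt.fstHom ℂ (Poly V) (Poly V)).comp (dualLift f) = AlgHom.id ℂ (Poly V) := by
    apply SymmetricAlgebra.algHom_ext
    ext v
    simp [dualLift_ι]
  exact congrArg (fun F : Poly V →ₐ[ℂ] Poly V => F b) h

/-- The unique `ℂ`-derivation of `S(V)` extending a given linear map `V → S(V)`. -/
def extendDerivation (f : V →ₗ[ℂ] Poly V) : Derivation ℂ (Poly V) (Poly V) :=
  Derivation.mk'
    (((TrivSqZeroExt.sndHom (Poly V) (Poly V)).restrictScalars ℂ) ∘ₗ (dualLift f).toLinearMap)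
    (fun a b => by
      simp [dualLift_fst, mul_comm])

theorem extendDerivation_ι (f : V →ₗ[ℂ] Poly V) (v : V) :
    extendDerivation f (SymmetricAlgebra.ι ℂ V v) = f v := by
  simp [extendDerivation, dualLift_ι]

theorem derivation_ext {d₁ d₂ : Derivation ℂ (Poly V) (Poly V)}
    (h : ∀ v, d₁ (SymmetricAlgebra.ι ℂ V v) = d₂ (SymmetricAlgebra.ι ℂ V v)) : d₁ = d₂ := by
  ext b
  induction b using SymmetricAlgebra.induction with
  | algebraMap r => simp
  | ι x => exact h x
  | mul a b ha hb => simp [ha, hb]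
  | add a b ha hb => simp [ha, hb]

/-- The constant derivation `∂_φ` of `S(V)` attached to `φ ∈ V*`: it sends `v ∈ V` to `φ(v)`. -/
def constDerivation (φ : Module.Dual ℂ V) : Derivation ℂ (Poly V) (Poly V) :=
  extendDerivation ((Algebra.linearMap ℂ (Poly V)) ∘ₗ φ)

variable (V)

/-- The Euler operator `∇ = x₁∂₁ + ⋯ + xₙ∂ₙ`, i.e. the derivation of `S(V)` with `∇ v = v` for all
`v ∈ V`. -/
def euler : Module.End ℂ (Poly V) :=
  (extendDerivation (SymmetricAlgebra.ι ℂ V)).toLinearMap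

/-- The algebra `D_B` of differential operators on `B = S(V)`, i.e. the Weyl algebra: the algebra of
operators on `S(V)` generated by the multiplications by the `v ∈ V` (the `xᵢ`) and the constant
derivations `∂_φ`, `φ ∈ V*` (the `∂ᵢ`). -/
def diffOps : Subalgebra ℂ (Module.End ℂ (Poly V)) :=
  Algebra.adjoin ℂ
    (Set.range (fun v : V => LinearMap.mulLeft ℂ (SymmetricAlgebra.ι ℂ V v)) ∪
      Set.range (fun φ : Module.Dual ℂ V => (constDerivation φ).toLinearMap))

variable {V}

/-- The action of `g ∈ GL(V)` on `S(V)` by algebra automorphisms, extending its action on `V`. -/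
def act (g : LinearMap.GeneralLinearGroup ℂ V) : Poly V →ₐ[ℂ] Poly V :=
  SymmetricAlgebra.lift (SymmetricAlgebra.ι ℂ V ∘ₗ (g : V →ₗ[ℂ] V))

end Polynomials

section Invariants

variable {V : Type u} [AddCommGroup V] [Module ℂ V]
variable (G : Subgroup (LinearMap.GeneralLinearGroup ℂ V))

/-- The action of `g ∈ GL(V)` on operators on `S(V)`: `P ↦ g ∘ P ∘ g⁻¹`. -/
def conjAct (g : LinearMap.GeneralLinearGroup ℂ V) (P : Module.End ℂ (Poly V)) :
    Module.End ℂ (Poly V) :=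
  (act g).toLinearMap ∘ₗ P ∘ₗ (act g⁻¹).toLinearMap

theorem act_mul_inv (g h : LinearMap.GeneralLinearGroup ℂ V) (hgh : g * h = 1) (b : Poly V) :
    act g (act h b) = b := by
  have key : (act g).comp (act h) = AlgHom.id ℂ (Poly V) := by
    apply SymmetricAlgebra.algHom_ext
    ext v
    have hv : (g : V →ₗ[ℂ] V) ((h : V →ₗ[ℂ] V) v) = v := by
      have := congrArg (fun k : LinearMap.GeneralLinearGroup ℂ V => (k : V →ₗ[ℂ] V) v) hgh
      simpa using this
    simp [act, hv]
  exact congrArg (fun F : Poly V →ₐ[ℂ] Poly V => F b) key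

theorem conjAct_eq_iff (g : LinearMap.GeneralLinearGroup ℂ V) (P : Module.End ℂ (Poly V)) :
    conjAct g P = P ↔ ∀ b, act g (P b) = P (act g b) := by
  constructor
  · intro h b
    have := LinearMap.congr_fun h (act g b)
    simpa [conjAct, act_mul_inv g⁻¹ g (by simp)] using this
  · intro h
    ext b
    simp [conjAct, h, act_mul_inv g g⁻¹ (by simp)]

/-- The algebra `D = D_B^G` of `G`-invariant differential operators on `B = S(V)`. -/
def invDiffOps : Subalgebra ℂ (Module.End ℂ (Poly V)) where
  carrier := {P | P ∈ diffOps V ∧ ∀ g ∈ G, conjAct g P = P}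
  mul_mem' := by
    rintro P Q ⟨hP, hP'⟩ ⟨hQ, hQ'⟩
    refine ⟨mul_mem hP hQ, fun g hg => (conjAct_eq_iff g _).2 fun b => ?_⟩
    simp [(conjAct_eq_iff g P).1 (hP' g hg), (conjAct_eq_iff g Q).1 (hQ' g hg)]
  add_mem' := by
    rintro P Q ⟨hP, hP'⟩ ⟨hQ, hQ'⟩
    refine ⟨add_mem hP hQ, fun g hg => (conjAct_eq_iff g _).2 fun b => ?_⟩
    simp [(conjAct_eq_iff g P).1 (hP' g hg), (conjAct_eq_iff g Q).1 (hQ' g hg)]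
  algebraMap_mem' := by
    intro c
    refine ⟨Subalgebra.algebraMap_mem _ c, fun g hg => (conjAct_eq_iff g _).2 fun b => ?_⟩
    simp [Module.algebraMap_end_apply]

theorem euler_mem_diffOps [FiniteDimensional ℂ V] : euler V ∈ diffOps V := by
  let e := Module.finBasis ℂ V
  have hs (b : Poly V) : (∑ i, SymmetricAlgebra.ι ℂ V (e i) • constDerivation (e.coord i)) b =
      ∑ i, SymmetricAlgebra.ι ℂ V (e i) * constDerivation (e.coord i) b := by
    have h1 := map_sum (Derivation.coeFnAddMonoidHom (R := ℂ) (A := Poly V) (M := Poly V))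
      (fun i => SymmetricAlgebra.ι ℂ V (e i) • constDerivation (e.coord i)) Finset.univ
    refine (congrFun h1 b).trans ?_
    simp [Finset.sum_apply, Derivation.coeFnAddMonoidHom]
  have key : ∑ i, SymmetricAlgebra.ι ℂ V (e i) • constDerivation (e.coord i) =
      extendDerivation (SymmetricAlgebra.ι ℂ V) := by
    apply derivation_ext
    intro v
    rw [extendDerivation_ι, hs]
    conv_rhs => rw [← e.sum_repr v]
    simp only [map_sum, map_smul, constDerivation, extendDerivation_ι]
    refine Finset.sum_congr rfl fun i _ => ?_
    simp [Algebra.smul_def, mul_comm]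
  have h2 : euler V = ∑ i, LinearMap.mulLeft ℂ (SymmetricAlgebra.ι ℂ V (e i)) *
      (constDerivation (e.coord i)).toLinearMap := by
    ext b
    have := congrArg (fun d : Derivation ℂ (Poly V) (Poly V) => d b) key
    rw [hs] at this
    simpa [euler, LinearMap.sum_apply] using this.symm
  rw [h2]
  refine sum_mem fun i _ => mul_mem ?_ ?_
  · exact Algebra.subset_adjoin (Or.inl ⟨e i, rfl⟩)
  · exact Algebra.subset_adjoin (Or.inr ⟨e.coord i, rfl⟩)

theorem euler_mem [FiniteDimensional ℂ V] : euler V ∈ invDiffOps G := by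
  refine ⟨euler_mem_diffOps, fun g _ => (conjAct_eq_iff g _).2 fun b => ?_⟩
  change act g (extendDerivation _ b) = extendDerivation _ (act g b)
  induction b using SymmetricAlgebra.induction with
  | algebraMap r => simp
  | ι x => simp [act, extendDerivation_ι]
  | mul a b ha hb => simp [ha, hb]
  | add a b ha hb => simp [ha, hb]

/-- The algebra `D = D_B^G`, as a type. -/
def D : Type u := invDiffOps G

instance : Ring (D G) := inferInstanceAs (Ring (invDiffOps G))

instance : Algebra ℂ (D G) := inferInstanceAs (Algebra ℂ (invDiffOps G))

instance : Module (D G) (Poly V) := inferInstanceAs (Module (invDiffOps G) (Poly V))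

instance : IsScalarTower ℂ (D G) (Poly V) :=
  inferInstanceAs (IsScalarTower ℂ (invDiffOps G) (Poly V))

theorem D_smul_def (P : D G) (b : Poly V) : P • b = P.1 b := rfl

variable [FiniteDimensional ℂ V]

/-- The Euler operator `∇` as an element of `D`. -/
def nabla : D G := ⟨euler V, euler_mem G⟩

/-- The ring `R = D⁰ / (D⁰ ∩ D D⁻)` for `D = D_B^G`. -/
abbrev RG : Type u := R (nabla G)

/-- `B^ann = Ann_{D⁻}(B)` for `D = D_B^G`. -/
abbrev Bann : Submodule (D0 (nabla G)) (Poly V) := Mann (nabla G) (Poly V)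

end Invariants

end InvDiff

end

/-! The argument has two inputs: `B` is a semisimple `D`-module, and the weights of `∇` on `B` are
bounded below.

Semisimplicity comes from the group. The Weyl algebra acts on `B` as a simple module whose
endomorphisms are scalars, so by Jacobson density it realises any linear map on a finite set.
Averaging over `G` then realises any equivariant map at a given vector by an element of `D`
(`exists_smul_eq_of_equivariant`). Combined with Maschke's theorem, this makes every nonzero vector
of a simple `G`-subrepresentation generate a simple `D`-module (`isSimpleModule_span_singleton`),
and such vectors span `B`.

The correspondence is then formal for any semisimple module satisfying `IsGradedPair`. A nonzero
submodule has a nonzero vector of least weight, which `D⁻` kills. Hence a complement of `D N^ann`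
meets `N` trivially, and `D N^ann = N` (`gen_ann`). Conversely, a lowest weight vector `y` generates
no weight below its own. Projecting equivariantly onto `D y` shows that `y` cannot be produced from
lower weights unless it is zero, so `(D W)^ann = W` (`ann_gen`). Full faithfulness follows by
applying the correspondence in `M × M` to the graph of an `R`-linear map (`annMap_surjective`).

Finite-dimensionality uses that `B` is finite over its invariants, hence Noetherian over `D`. The
degree filtration of `B^ann` corresponds to an ascending chain of `D`-submodules, so it stops. -/

open CategoryTheory

noncomputable section

namespace InvDiff

universe u

/-! ### Weight spaces of `∇` and lowest weight vectors -/

section Weights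

variable {D : Type u} [Ring D] [Algebra ℂ D] (nab : D)
variable (M : Type u) [AddCommGroup M] [Module D M] [Module ℂ M] [IsScalarTower ℂ D M]

/-- The space of vectors of weight `e`, i.e. the eigenspace of `∇` for the eigenvalue `e`. -/
def wt (e : ℤ) : Submodule ℂ M where
  carrier := {m | nab • m = e • m}
  add_mem' := by
    intro a b ha hb
    change nab • _ = _ at ha hb
    change nab • _ = _
    rw [smul_add, smul_add, ha, hb]
  zero_mem' := by
    change nab • _ = _
    rw [smul_zero, smul_zero]
  smul_mem' := by
    intro c m hm
    change nab • _ = _ at hm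
    change nab • _ = _
    rw [smul_comm e c m, ← hm, ← algebraMap_smul D c m, ← algebraMap_smul D c (nab • m),
      ← mul_smul, ← mul_smul, Algebra.commutes]

variable {M}

theorem mem_wt {e : ℤ} {m : M} : m ∈ wt nab M e ↔ nab • m = e • m := Iff.rfl

theorem smul_mem_wt {n e : ℤ} {P : D} {m : M} (hP : P ∈ degPart nab n) (hm : m ∈ wt nab M e) :
    P • m ∈ wt nab M (n + e) := by
  have hP' : nab * P - P * nab = n • P := hP
  rw [mem_wt] at hm ⊢
  rw [← mul_smul, sub_eq_iff_eq_add.1 hP', add_smul, mul_smul, hm, add_smul, smul_assoc,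
    smul_comm P e m]

theorem mem_of_int_smul_mem (p : Submodule ℂ M) {k : ℤ} (hk : k ≠ 0) {m : M} (h : k • m ∈ p) :
    m ∈ p := by
  rw [← Int.cast_smul_eq_zsmul ℂ] at h
  exact (p.smul_mem_iff (Int.cast_ne_zero.2 hk)).1 h

/-- Eigenvectors for distinct eigenvalues separate: applying `∇ - a` removes the component of weight
`a` and multiplies each other one by the nonzero integer `i - a`, which can be divided out over `ℂ`.
-/
theorem component_mem_of_sum_mem (p : Submodule ℂ M) (hp : ∀ m ∈ p, nab • m ∈ p) (s : Finset ℤ) :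
    ∀ x : ℤ → M, (∀ i ∈ s, x i ∈ wt nab M i) → ∑ i ∈ s, x i ∈ p → ∀ i ∈ s, x i ∈ p := by
  classical
  induction s using Finset.induction_on with
  | empty => simp
  | insert a s ha ih =>
    intro x hx hsum
    have h1 : ∑ i ∈ s, (i - a) • x i ∈ p := by
      have h2 := sub_mem (hp _ hsum) (zsmul_mem hsum a)
      rw [Finset.smul_sum, Finset.smul_sum, ← Finset.sum_sub_distrib,
        Finset.sum_insert ha, (mem_wt nab).1 (hx a (by simp)), sub_self, zero_add] at h2
      convert h2 using 1
      refine Finset.sum_congr rfl fun i hi => ?_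
      rw [(mem_wt nab).1 (hx i (by simp [hi])), sub_smul]
    have h3 : ∀ i ∈ s, x i ∈ p := by
      intro i hi
      have := ih (fun i => (i - a) • x i)
        (fun i hi => zsmul_mem (hx i (by simp [hi])) _) h1 i hi
      refine mem_of_int_smul_mem p (k := i - a) ?_ this
      rintro h
      rw [sub_eq_zero.1 h] at hi
      exact ha hi
    intro i hi
    rcases Finset.mem_insert.1 hi with rfl | hi
    · rw [Finset.sum_insert ha] at hsum
      simpa using sub_mem hsum (sum_mem h3)
    · exact h3 i hi

/-- Uniqueness of the weight decomposition, in the form used throughout: a homogeneous vector of a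
sum of homogeneous subspaces already lies in the summand of its own weight. -/
theorem mem_of_mem_iSup_of_mem_wt (S : ℤ → Submodule ℂ M) (hS : ∀ e, S e ≤ wt nab M e) {d : ℤ}
    {x : M} (hx : x ∈ wt nab M d) (hxS : x ∈ ⨆ e, S e) : x ∈ S d := by
  classical
  obtain ⟨f, hf, rfl⟩ := (Submodule.mem_iSup_iff_exists_finsupp _ _).1 hxS
  -- The decomposition minus `x` placed in weight `d` sums to zero. Taking the stable subspace to be
  -- `⊥` forces every term to vanish, and the term at `d` gives `f d = x`.
  have key := component_mem_of_sum_mem nab (⊥ : Submodule ℂ M) (by simp) (insert d f.support)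
    (fun i => f i - if i = d then f.sum fun _ y => y else 0) (by
      intro i _
      refine sub_mem (hS i (hf i)) ?_
      split_ifs with h
      · rw [h]; exact hx
      · exact zero_mem _) (by
      rw [Submodule.mem_bot, Finset.sum_sub_distrib, Finset.sum_ite_eq' _ d, if_pos (by simp),
        sub_eq_zero]
      exact (Finsupp.sum_of_support_subset f (Finset.subset_insert _ _) (fun _ y => y)
        (by simp)).symm) d (by simp)
  rw [if_pos rfl, Submodule.mem_bot, sub_eq_zero] at key
  exact key ▸ hf d

variable (M)

/-- `D` is the sum of its homogeneous components and `M` is the sum of its weight spaces of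
non-negative weight. -/
structure IsGradedPair : Prop where
  iSup_degPart : ⨆ n, degPart nab n = ⊤
  iSup_wt : ⨆ d : ℕ, wt nab M d = ⊤

variable {M} {nab}
variable (H : IsGradedPair nab M)

include H

theorem IsGradedPair.mem_iSup_inf_wt (p : Submodule ℂ M) (hp : ∀ m ∈ p, nab • m ∈ p) {x : M}
    (hx : x ∈ p) : x ∈ ⨆ d : ℕ, p ⊓ wt nab M d := by
  classical
  have hx' : x ∈ ⨆ d : ℕ, wt nab M d := by rw [H.iSup_wt]; trivial
  obtain ⟨f, hf, rfl⟩ := (Submodule.mem_iSup_iff_exists_finsupp _ _).1 hx'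
  have hsum : ∑ i ∈ f.support.map (Nat.castEmbedding (R := ℤ)), f (Int.toNat i) ∈ p := by
    rw [Finset.sum_map]
    simpa [Finsupp.sum] using hx
  have key := component_mem_of_sum_mem nab p hp _ (fun i => f (Int.toNat i)) (by
    intro i hi
    obtain ⟨d, _, rfl⟩ := Finset.mem_map.1 hi
    simpa using hf d) hsum
  refine sum_mem fun d hd => Submodule.mem_iSup_of_mem d ⟨?_, hf d⟩
  simpa using key d (by simpa using hd)

theorem IsGradedPair.eq_zero_of_neg {e : ℤ} (he : e < 0) {x : M} (hx : x ∈ wt nab M e) :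
    x = 0 := by
  have h := mem_of_mem_iSup_of_mem_wt nab (fun e => if 0 ≤ e then wt nab M e else ⊥)
    (fun e => by split_ifs <;> simp) hx (by
      have hx' : x ∈ ⨆ d : ℕ, wt nab M d := by rw [H.iSup_wt]; trivial
      refine (show ⨆ d : ℕ, wt nab M d ≤ _ from iSup_le fun d => ?_) hx'
      refine le_trans ?_ (le_iSup _ (d : ℤ))
      simp)
  simpa [not_le.2 he] using h

/-- A nonzero `D`-submodule contains a nonzero lowest weight vector. -/
theorem IsGradedPair.exists_lowest (N : Submodule D M) (hN : N ≠ ⊥) :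
    ∃ x ∈ N, x ≠ 0 ∧ ∀ P ∈ Dneg nab, P • x = 0 := by
  classical
  have h1 : ∃ d : ℕ, ∃ x ∈ N, x ≠ 0 ∧ x ∈ wt nab M d := by
    by_contra! h
    apply hN
    rw [eq_bot_iff]
    intro x hx
    have := H.mem_iSup_inf_wt (N.restrictScalars ℂ) (fun m hm => N.smul_mem _ hm) hx
    have h2 : ⨆ d : ℕ, N.restrictScalars ℂ ⊓ wt nab M d = ⊥ := by
      rw [iSup_eq_bot]
      intro d
      rw [eq_bot_iff]
      rintro y ⟨hy1, hy2⟩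
      by_contra hy0
      exact h d y hy1 hy0 hy2
    rw [h2] at this
    exact this
  obtain ⟨x, hxN, hx0, hxw⟩ := Nat.find_spec h1
  refine ⟨x, hxN, hx0, fun P hP => ?_⟩
  refine Submodule.iSup_induction (motive := fun P => P • x = 0) _ hP ?_ (zero_smul _ _) ?_
  · rintro ⟨n, hn⟩ P hP
    have hw := smul_mem_wt nab hP hxw
    by_contra h0
    -- The weight `n + d` is smaller than the least weight `d` occurring in `N`: if negative it does
    -- not occur in `M`, otherwise it contradicts minimality.
    rcases lt_or_ge (n + (Nat.find h1 : ℤ)) 0 with hneg | hpos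
    · exact h0 (H.eq_zero_of_neg hneg hw)
    · refine Nat.find_min h1 (m := (n + (Nat.find h1 : ℤ)).toNat) (by omega)
        ⟨P • x, N.smul_mem _ hxN, h0, ?_⟩
      rwa [Int.toNat_of_nonneg hpos]
  · intro a b ha hb
    rw [add_smul, ha, hb, add_zero]

theorem IsGradedPair.eq_bot_of_ann_eq_bot {N : Submodule D M} (hN : ann nab N = ⊥) : N = ⊥ := by
  by_contra h
  obtain ⟨x, hx, hx0, hxP⟩ := H.exists_lowest N h
  have : (⟨x, hxP⟩ : Mann nab M) ∈ ann nab N := hx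
  rw [hN] at this
  exact hx0 (congrArg Subtype.val ((Submodule.mem_bot _).1 this))

end Weights

/-! ### The two constructions are mutually inverse -/

section AnnGen

variable {D : Type u} [Ring D] [Algebra ℂ D] {nab : D}
variable {M : Type u} [AddCommGroup M] [Module D M]

theorem mem_gen {W : Submodule (R nab) (Mann nab M)} {b : Mann nab M} (hb : b ∈ W) :
    (b : M) ∈ gen nab W := Submodule.subset_span ⟨b, hb, rfl⟩

theorem gen_le {W : Submodule (R nab) (Mann nab M)} {N : Submodule D M} :
    gen nab W ≤ N ↔ W ≤ ann nab N := by
  rw [gen, Submodule.span_le]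
  constructor
  · intro h b hb
    exact h ⟨b, hb, rfl⟩
  · rintro h _ ⟨b, hb, rfl⟩
    exact h hb

theorem ann_mono {N₁ N₂ : Submodule D M} (h : N₁ ≤ N₂) : ann nab N₁ ≤ ann nab N₂ :=
  fun _ hb => h hb

theorem gen_mono {W₁ W₂ : Submodule (R nab) (Mann nab M)} (h : W₁ ≤ W₂) :
    gen nab W₁ ≤ gen nab W₂ := gen_le.2 fun _ hb => mem_gen (h hb)

theorem D0_smul_mem (W : Submodule (R nab) (Mann nab M)) {P : D} (hP : P ∈ degPart nab 0)
    {b : Mann nab M} (hb : b ∈ W) : ∃ c ∈ W, (c : M) = P • (b : M) :=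
  ⟨Ideal.Quotient.mk (relIdeal nab) ⟨P, hP⟩ • b, W.smul_mem _ hb, mk_smul nab ⟨P, hP⟩ b⟩

theorem nab_mem : nab ∈ degPart nab 0 := by
  change nab * nab - nab * nab = _
  simp

theorem algebraMap_mem_degPart (c : ℂ) : algebraMap ℂ D c ∈ degPart nab 0 :=
  (D0 nab).algebraMap_mem c

variable [Module ℂ M] [IsScalarTower ℂ D M]

/-- An `R`-submodule of `M^ann`, as a complex subspace of `M`. -/
def toSubspace (W : Submodule (R nab) (Mann nab M)) : Submodule ℂ M where
  carrier := {m | ∃ b ∈ W, (b : M) = m}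
  add_mem' := by
    rintro _ _ ⟨a, ha, rfl⟩ ⟨b, hb, rfl⟩
    exact ⟨a + b, add_mem ha hb, rfl⟩
  zero_mem' := ⟨0, zero_mem _, rfl⟩
  smul_mem' := by
    rintro c _ ⟨b, hb, rfl⟩
    obtain ⟨a, ha, h⟩ := D0_smul_mem W (algebraMap_mem_degPart c) hb
    exact ⟨a, ha, by rw [h, algebraMap_smul]⟩

theorem mem_toSubspace {W : Submodule (R nab) (Mann nab M)} {b : Mann nab M} :
    (b : M) ∈ toSubspace W ↔ b ∈ W := by
  constructor
  · rintro ⟨c, hc, h⟩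
    exact Subtype.ext h ▸ hc
  · exact fun h => ⟨b, h, rfl⟩

theorem nab_smul_mem_toSubspace (W : Submodule (R nab) (Mann nab M)) :
    ∀ m ∈ toSubspace W, nab • m ∈ toSubspace W := by
  rintro _ ⟨b, hb, rfl⟩
  exact D0_smul_mem W nab_mem hb

variable (H : IsGradedPair nab M)

include H

/-- A complement of `D N^ann` meets `N` in a submodule without nonzero lowest weight vectors, hence
in zero; the modular law then gives equality. -/
theorem gen_ann [IsSemisimpleModule D M] (N : Submodule D M) : gen nab (ann nab N) = N := by
  have hle : gen nab (ann nab N) ≤ N := gen_le.2 le_rfl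
  obtain ⟨C, hC⟩ := exists_isCompl (gen nab (ann nab N))
  have h0 : N ⊓ C = ⊥ := by
    refine H.eq_bot_of_ann_eq_bot ?_
    rw [eq_bot_iff]
    intro b hb
    have h1 : (b : M) ∈ gen nab (ann nab N) ⊓ C := ⟨mem_gen hb.1, hb.2⟩
    rw [hC.inf_eq_bot] at h1
    exact Subtype.ext ((Submodule.mem_bot _).1 h1)
  refine le_antisymm hle ?_
  have := hC.sup_eq_top
  calc N = (gen nab (ann nab N) ⊔ C) ⊓ N := by rw [this, top_inf_eq]
    _ = gen nab (ann nab N) ⊔ C ⊓ N := sup_inf_assoc_of_le C hle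
    _ ≤ gen nab (ann nab N) := by rw [inf_comm C, h0, sup_bot_eq]

/-- A submodule generated by a lowest weight vector of weight `d` has no weights below `d`. -/
theorem eq_zero_of_mem_span_singleton {y : M} {d e : ℤ} (hy : ∀ P ∈ Dneg nab, P • y = 0)
    (hd : y ∈ wt nab M d) (hed : e < d) {z : M} (hz : z ∈ Submodule.span D {y})
    (hze : z ∈ wt nab M e) : z = 0 := by
  obtain ⟨P, rfl⟩ := Submodule.mem_span_singleton.1 hz
  have hP : P ∈ ⨆ n, degPart nab n := by rw [H.iSup_degPart]; trivial
  have h := mem_of_mem_iSup_of_mem_wt nab (fun e => if d ≤ e then wt nab M e else ⊥)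
    (fun e => by split_ifs <;> simp) hze (by
      refine Submodule.iSup_induction
        (motive := fun P => P • y ∈ ⨆ e, if d ≤ e then wt nab M e else ⊥) _ hP ?_ ?_ ?_
      · intro n P hP
        rcases lt_or_ge n 0 with hn | hn
        · rw [hy P (Submodule.mem_iSup_of_mem ⟨n, hn⟩ hP)]
          exact zero_mem _
        · refine Submodule.mem_iSup_of_mem (n + d) ?_
          rw [if_pos (by omega)]
          exact smul_mem_wt nab hP hd
      · rw [zero_smul]
        exact zero_mem _
      · intro a b ha hb
        rw [add_smul]
        exact add_mem ha hb)
  simpa [not_le.2 hed] using h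

/-- A lowest weight vector of weight `d` in the submodule generated by vectors of weight less than
`d` vanishes. -/
theorem eq_zero_of_mem_span_lower [IsSemisimpleModule D M] {y : M} {d : ℤ}
    (hy : ∀ P ∈ Dneg nab, P • y = 0) (hd : y ∈ wt nab M d)
    (hspan : y ∈ Submodule.span D {w : M | ∃ e < d, w ∈ wt nab M e}) : y = 0 := by
  obtain ⟨C, hC⟩ := exists_isCompl (Submodule.span D {y})
  have hle : Submodule.span D {w : M | ∃ e < d, w ∈ wt nab M e} ≤ C := by
    rw [Submodule.span_le]
    rintro w ⟨e, he, hw⟩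
    -- The projection onto `D y` along `C` is `D`-linear, so it preserves weights; a vector of
    -- weight below `d` must go to zero, as `D y` has no such weights.
    rw [SetLike.mem_coe, ← Submodule.projection_apply_eq_zero_iff hC]
    refine eq_zero_of_mem_span_singleton H hy hd he (Submodule.projection_apply_mem hC w) ?_
    rw [mem_wt] at hw ⊢
    rw [← map_smul, hw, map_zsmul]
  have h1 : y ∈ Submodule.span D {y} ⊓ C := ⟨Submodule.mem_span_singleton_self y, hle hspan⟩
  rw [hC.inf_eq_bot] at h1
  exact (Submodule.mem_bot _).1 h1

/-- In weight `d`, the module `D W` consists of vectors of `W` plus vectors raised from lower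
weights, since `D⁻` kills `W` and `D⁰` preserves it. For a lowest weight vector the raised part is
again a lowest weight vector, so `eq_zero_of_mem_span_lower` removes it. -/
theorem ann_gen [IsSemisimpleModule D M] (W : Submodule (R nab) (Mann nab M)) :
    ann nab (gen nab W) = W := by
  refine le_antisymm ?_ (gen_le.1 le_rfl)
  set K : ℤ → Submodule ℂ M := fun d =>
    (Submodule.span D {w : M | ∃ e < d, w ∈ wt nab M e}).restrictScalars ℂ with hK
  -- The summand of weight `e` separates the contribution of degree zero operators from that of
  -- positive degree operators, which start in weights below `e`.
  set S : ℤ → Submodule ℂ M := fun e => toSubspace W ⊓ wt nab M e ⊔ K e ⊓ wt nab M e with hS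
  have hgen : ∀ x ∈ gen nab W, x ∈ ⨆ e, S e := by
    have hbase : ∀ w ∈ toSubspace W, ∀ P : D, P • w ∈ ⨆ e, S e := by
      intro w hw P
      have hw' := H.mem_iSup_inf_wt _ (nab_smul_mem_toSubspace W) hw
      have hP : P ∈ ⨆ n, degPart nab n := by rw [H.iSup_degPart]; trivial
      refine Submodule.iSup_induction (motive := fun w => P • w ∈ ⨆ e, S e) _ hw' ?_ ?_ ?_
      · rintro d w ⟨⟨b, hb, rfl⟩, hwd⟩
        refine Submodule.iSup_induction
          (motive := fun P : D => P • (b : M) ∈ ⨆ e, S e) _ hP ?_ ?_ ?_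
        · intro n P hP
          have hwt := smul_mem_wt nab hP hwd
          refine Submodule.mem_iSup_of_mem (n + d) ?_
          rcases lt_trichotomy n 0 with hn | rfl | hn
          · rw [b.2 P (Submodule.mem_iSup_of_mem ⟨n, hn⟩ hP)]
            exact zero_mem _
          · obtain ⟨c, hc, h⟩ := D0_smul_mem W hP hb
            exact Submodule.mem_sup_left ⟨⟨c, hc, h⟩, hwt⟩
          · refine Submodule.mem_sup_right
              ⟨Submodule.smul_mem _ P (Submodule.subset_span ?_), hwt⟩
            exact ⟨d, by omega, hwd⟩
        · rw [zero_smul]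
          exact zero_mem _
        · intro a c ha hc
          rw [add_smul]
          exact add_mem ha hc
      · rw [smul_zero]
        exact zero_mem _
      · intro a c ha hc
        rw [smul_add]
        exact add_mem ha hc
    intro x hx
    suffices h : ∀ P : D, P • x ∈ ⨆ e, S e by simpa using h 1
    refine Submodule.span_induction (p := fun x _ => ∀ P : D, P • x ∈ ⨆ e, S e) ?_ ?_ ?_ ?_ hx
    · rintro _ ⟨b, hb, rfl⟩ P
      exact hbase _ ⟨b, hb, rfl⟩ P
    · intro P
      rw [smul_zero]
      exact zero_mem _
    · intro a b _ _ ha hb P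
      rw [smul_add]
      exact add_mem (ha P) (hb P)
    · intro Q a _ ha P
      rw [← mul_smul]
      exact ha _
  intro b hb
  have hb' := H.mem_iSup_inf_wt _ (nab_smul_mem_toSubspace (ann nab (gen nab W)))
    (mem_toSubspace.2 hb)
  rw [← mem_toSubspace]
  refine (show ⨆ d : ℕ, toSubspace (ann nab (gen nab W)) ⊓ wt nab M d ≤ _ from
    iSup_le fun d => ?_) hb'
  rintro _ ⟨⟨x, hx, rfl⟩, hxd⟩
  have hxS := mem_of_mem_iSup_of_mem_wt nab S (fun e => sup_le inf_le_right inf_le_right) hxd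
    (hgen _ hx)
  obtain ⟨_, ⟨⟨w, hw, rfl⟩, hwd⟩, k, hk, hwk⟩ := Submodule.mem_sup.1 hxS
  -- The raised part is the difference of two elements of `M^ann`, hence itself killed by `D⁻`.
  have hkx : k = ((x - w : Mann nab M) : M) := by
    rw [← add_sub_cancel_left (w : M) k, hwk]
    rfl
  have hk0 : k = 0 := eq_zero_of_mem_span_lower H (by rw [hkx]; exact (x - w).2) hk.2 hk.1
  rw [← hwk, hk0, add_zero]
  exact ⟨w, hw, rfl⟩

end AnnGen

/-! ### Lattice isomorphism and lifting of morphisms -/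

section Correspondence

variable {D : Type u} [Ring D] [Algebra ℂ D] {nab : D}
variable {M : Type u} [AddCommGroup M] [Module D M] [Module ℂ M] [IsScalarTower ℂ D M]

/-- The isomorphism `N ↦ N^ann` of submodule lattices, with inverse `W ↦ D W`. -/
def annIso (H : IsGradedPair nab M) [IsSemisimpleModule D M] :
    Submodule D M ≃o Submodule (R nab) (Mann nab M) where
  toFun := ann nab
  invFun := gen nab
  left_inv := gen_ann H
  right_inv := ann_gen H
  map_rel_iff' {N₁ N₂} := by
    refine ⟨fun h => ?_, ann_mono⟩
    rw [← gen_ann H N₁, ← gen_ann H N₂]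
    exact gen_mono h

theorem isSemisimpleModule_Mann (H : IsGradedPair nab M) [IsSemisimpleModule D M] :
    IsSemisimpleModule (R nab) (Mann nab M) :=
  { toComplementedLattice := (annIso H).complementedLattice }

theorem isSimpleModule_ann_iff (H : IsGradedPair nab M) [IsSemisimpleModule D M]
    (N : Submodule D M) : IsSimpleModule (R nab) (ann nab N) ↔ IsSimpleModule D N := by
  rw [isSimpleModule_iff_isAtom, isSimpleModule_iff_isAtom]
  exact (annIso H).isAtom_iff N

/-- A simple `R`-submodule of `M^ann` lies in a single weight space. -/
theorem IsGradedPair.exists_weight_of_isSimpleModule (H : IsGradedPair nab M)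
    (W : Submodule (R nab) (Mann nab M)) [hW : IsSimpleModule (R nab) W] :
    ∃ d : ℕ, ∀ b ∈ W, (b : M) ∈ wt nab M d := by
  -- The weight `d` part of `W` is an `R`-submodule because `D⁰` preserves weights. By simplicity it
  -- is `⊥` or `W`, and `W` is the sum of these parts.
  let Q (d : ℕ) : Submodule (R nab) (Mann nab M) :=
    { carrier := {b | b ∈ W ∧ (b : M) ∈ wt nab M d}
      add_mem' := fun ha hb => ⟨add_mem ha.1 hb.1, add_mem ha.2 hb.2⟩
      zero_mem' := ⟨zero_mem _, zero_mem _⟩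
      smul_mem' := by
        intro r b hb
        refine ⟨W.smul_mem r hb.1, ?_⟩
        obtain ⟨a, rfl⟩ := Ideal.Quotient.mk_surjective r
        rw [mk_smul]
        simpa using smul_mem_wt nab (show (a : D) ∈ degPart nab 0 from a.2) hb.2 }
  have hQ (d : ℕ) : Q d ≤ W := fun b hb => hb.1
  by_contra! hcon
  have hatom := isSimpleModule_iff_isAtom.1 hW
  have hbot (d : ℕ) : Q d = ⊥ := by
    rcases hatom.le_iff.1 (hQ d) with h | h
    · exact h
    · obtain ⟨b, hb, hbd⟩ := hcon d
      exact absurd (h.ge hb).2 hbd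
  refine hatom.1 (eq_bot_iff.2 fun b hb => ?_)
  have hb' := H.mem_iSup_inf_wt _ (nab_smul_mem_toSubspace W) (mem_toSubspace.2 hb)
  have h0 : ⨆ d : ℕ, toSubspace W ⊓ wt nab M d = ⊥ := by
    rw [iSup_eq_bot]
    intro d
    rw [eq_bot_iff]
    rintro _ ⟨⟨c, hc, rfl⟩, hcd⟩
    have : c ∈ Q d := ⟨hc, hcd⟩
    rw [hbot d] at this
    rw [(Submodule.mem_bot _).1 this]
    rfl
  rw [h0] at hb'
  exact Subtype.ext ((Submodule.mem_bot _).1 hb')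

/-- Makes the correspondence available in `M × M`, where graphs of maps live. -/
theorem IsGradedPair.prod (H : IsGradedPair nab M) : IsGradedPair nab (M × M) where
  iSup_degPart := H.iSup_degPart
  iSup_wt := by
    rw [eq_top_iff]
    rintro ⟨x, y⟩ -
    have hx : x ∈ ⨆ d : ℕ, wt nab M d := by rw [H.iSup_wt]; trivial
    have hy : y ∈ ⨆ d : ℕ, wt nab M d := by rw [H.iSup_wt]; trivial
    have h1 : (⨆ d : ℕ, wt nab M d) ≤ (⨆ d : ℕ, wt nab (M × M) d).comap (.inl ℂ M M) := by
      refine iSup_le fun d x hx => Submodule.mem_iSup_of_mem d ?_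
      change nab • (x, (0 : M)) = (d : ℤ) • (x, (0 : M))
      rw [Prod.smul_mk, Prod.smul_mk, (mem_wt nab).1 hx, smul_zero, smul_zero]
    have h2 : (⨆ d : ℕ, wt nab M d) ≤ (⨆ d : ℕ, wt nab (M × M) d).comap (.inr ℂ M M) := by
      refine iSup_le fun d x hx => Submodule.mem_iSup_of_mem d ?_
      change nab • ((0 : M), x) = (d : ℤ) • ((0 : M), x)
      rw [Prod.smul_mk, Prod.smul_mk, (mem_wt nab).1 hx, smul_zero, smul_zero]
    have h3 := add_mem (Submodule.mem_comap.1 (h1 hx)) (Submodule.mem_comap.1 (h2 hy))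
    simpa using h3

theorem annMap_injective (H : IsGradedPair nab M) [IsSemisimpleModule D M] {N₁ N₂ : Submodule D M}
    {f f' : N₁ →ₗ[D] N₂} (h : annMap nab f = annMap nab f') : f = f' := by
  have hle : N₁ ≤ (LinearMap.eqLocus f f').map N₁.subtype := by
    nth_rw 1 [← gen_ann H N₁]
    rw [gen_le]
    intro b hb
    refine ⟨⟨b, hb⟩, ?_, rfl⟩
    have := congrArg (fun y : ann nab N₂ => ((y : Mann nab M) : M))
      (LinearMap.congr_fun h ⟨b, hb⟩)
    exact Subtype.ext this
  refine LinearMap.ext fun x => ?_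
  obtain ⟨y, hy, hyx⟩ := hle x.2
  rw [← Subtype.ext hyx]
  exact hy

/-- The graph of `g` generates a `D`-submodule `L` of `M × M` whose lowest weight space is the graph
itself. Therefore the first projection from `L` to `N₁` is bijective, and `L` is the graph of the
required extension. -/
theorem annMap_surjective (H : IsGradedPair nab M) [IsSemisimpleModule D M] {N₁ N₂ : Submodule D M}
    (g : ann nab N₁ →ₗ[R nab] ann nab N₂) : ∃ f : N₁ →ₗ[D] N₂, annMap nab f = g := by
  have hprod : IsSemisimpleModule D (M × M) :=
    .congr (LinearEquiv.finTwoArrow D M).symm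
  let φ : ann nab N₁ →ₗ[R nab] Mann nab (M × M) :=
    { toFun := fun x => ⟨(((x : Mann nab M) : M), ((g x : Mann nab M) : M)), fun P hP =>
        Prod.ext (x.1.2 P hP) ((g x).1.2 P hP)⟩
      map_add' := fun x y => by
        apply Subtype.ext
        rw [g.map_add x y]
        rfl
      map_smul' := fun r x => by
        apply Subtype.ext
        rw [g.map_smul r x]
        obtain ⟨a, rfl⟩ := Ideal.Quotient.mk_surjective r
        rfl }
  set L : Submodule D (M × M) := gen nab (LinearMap.range φ) with hL
  have hann : ann nab L = LinearMap.range φ := ann_gen H.prod _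
  have hφL (x) : ((φ x : Mann nab (M × M)) : M × M) ∈ L := mem_gen ⟨x, rfl⟩
  have h1 : L ≤ N₁.prod N₂ := by
    rw [hL, gen_le]
    rintro _ ⟨x, rfl⟩
    exact ⟨x.2, (g x).2⟩
  let p₁ : L →ₗ[D] N₁ := (LinearMap.fst D M M).restrict fun x hx => (h1 hx).1
  let p₂ : L →ₗ[D] N₂ := (LinearMap.snd D M M).restrict fun x hx => (h1 hx).2
  have hinj : Function.Injective p₁ := by
    rw [← LinearMap.ker_eq_bot, eq_bot_iff]
    rintro ⟨y, hy⟩ hy0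
    -- A lowest weight vector of `L` is a point `(x, g x)`; if its first coordinate vanishes, so
    -- does the second.
    have hbot : L ⊓ LinearMap.ker (LinearMap.fst D M M) = ⊥ := by
      refine H.prod.eq_bot_of_ann_eq_bot (eq_bot_iff.2 ?_)
      rintro b ⟨hb1, hb2⟩
      have hb1' : b ∈ ann nab L := hb1
      rw [hann] at hb1'
      obtain ⟨x, rfl⟩ := hb1'
      have hx : x = 0 := Subtype.ext (Subtype.ext hb2)
      rw [hx, map_zero]
      exact zero_mem _
    have : y ∈ L ⊓ LinearMap.ker (LinearMap.fst D M M) := ⟨hy, congrArg Subtype.val hy0⟩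
    rw [hbot] at this
    exact Subtype.ext ((Submodule.mem_bot _).1 this)
  have hsurj : Function.Surjective p₁ := by
    -- By `gen_ann`, surjectivity need only be checked on `N₁^ann`, where the graph supplies the
    -- preimage.
    have hle : N₁ ≤ L.map (LinearMap.fst D M M) := by
      nth_rw 1 [← gen_ann H N₁]
      rw [gen_le]
      intro b hb
      exact ⟨_, hφL ⟨b, hb⟩, rfl⟩
    intro x
    obtain ⟨y, hy, hyx⟩ := hle x.2
    exact ⟨⟨y, hy⟩, Subtype.ext hyx⟩
  let e := LinearEquiv.ofBijective p₁ ⟨hinj, hsurj⟩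
  refine ⟨p₂ ∘ₗ e.symm.toLinearMap, LinearMap.ext fun x => Subtype.ext (Subtype.ext ?_)⟩
  have he : e.symm ⟨((x : Mann nab M) : M), x.2⟩ = ⟨_, hφL x⟩ := by
    rw [LinearEquiv.symm_apply_eq]
    rfl
  change ((p₂ (e.symm ⟨((x : Mann nab M) : M), x.2⟩) : N₂) : M) = _
  rw [he]
  rfl

end Correspondence

/-! ### Isomorphism of categories -/

section Functor

/-- A fully faithful functor that is strictly bijective on objects has a strict inverse. Morphisms
are lifted after transport along the object equalities, and faithfulness yields the functor laws. -/
theorem exists_inverse_functor {C C' : Type*} [Category C] [Category C'] (F : C ⥤ C')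
    [F.Full] [F.Faithful] (o : C' → C) (h₁ : ∀ X, o (F.obj X) = X) (h₂ : ∀ Y, F.obj (o Y) = Y) :
    ∃ δ : C' ⥤ C, (∀ Y, δ.obj Y = o Y) ∧ F ⋙ δ = 𝟭 C ∧ δ ⋙ F = 𝟭 C' := by
  refine ⟨{ obj := o
            map := fun {X Y} g => F.preimage (eqToHom (h₂ X) ≫ g ≫ eqToHom (h₂ Y).symm)
            map_id := fun X => F.map_injective (by simp)
            map_comp := fun f g => F.map_injective (by simp) }, fun Y => rfl, ?_, ?_⟩
  · refine CategoryTheory.Functor.ext h₁ fun X Y f => F.map_injective ?_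
    simp [eqToHom_map]
  · refine CategoryTheory.Functor.ext h₂ fun X Y f => ?_
    simp

variable {D : Type u} [Ring D] [Algebra ℂ D] {nab : D}
variable {M : Type u} [AddCommGroup M] [Module D M] [Module ℂ M] [IsScalarTower ℂ D M]

theorem annFunctor_full (H : IsGradedPair nab M) [IsSemisimpleModule D M] :
    (annFunctor nab M).Full where
  map_surjective {N₁ N₂} g := by
    obtain ⟨f, hf⟩ := annMap_surjective (N₁ := N₁) (N₂ := N₂) H g.hom.hom
    refine ⟨InducedCategory.homMk (ModuleCat.ofHom f), ?_⟩
    apply InducedCategory.hom_ext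
    apply ModuleCat.hom_ext
    exact hf

theorem annFunctor_faithful (H : IsGradedPair nab M) [IsSemisimpleModule D M] :
    (annFunctor nab M).Faithful where
  map_injective {N₁ N₂} f f' h := by
    apply InducedCategory.hom_ext
    apply ModuleCat.hom_ext
    exact annMap_injective H (congrArg (fun k => k.hom.hom) h)

theorem exists_inverse_annFunctor (H : IsGradedPair nab M) [IsSemisimpleModule D M] :
    ∃ δ : ModSub (R nab) (Mann nab M) ⥤ ModSub D M,
      (∀ W : Submodule (R nab) (Mann nab M), δ.obj W = gen nab W) ∧
      annFunctor nab M ⋙ δ = 𝟭 _ ∧ δ ⋙ annFunctor nab M = 𝟭 _ := by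
  have := annFunctor_full H
  have := annFunctor_faithful H
  exact exists_inverse_functor (annFunctor nab M) (gen nab) (gen_ann H) (ann_gen H)

end Functor

/-! ### Euler weights of `S(V)` are degrees -/

section PolynomialWeights

variable {V : Type u} [AddCommGroup V] [Module ℂ V]

theorem euler_ι (v : V) : euler V (SymmetricAlgebra.ι ℂ V v) = SymmetricAlgebra.ι ℂ V v :=
  extendDerivation_ι _ v

theorem euler_mul (a b : Poly V) : euler V (a * b) = a * euler V b + b * euler V a :=
  (extendDerivation (SymmetricAlgebra.ι ℂ V)).leibniz a b

theorem euler_algebraMap (c : ℂ) : euler V (algebraMap ℂ (Poly V) c) = 0 :=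
  (extendDerivation (SymmetricAlgebra.ι ℂ V)).map_algebraMap c

theorem constDerivation_ι (φ : Module.Dual ℂ V) (v : V) :
    constDerivation φ (SymmetricAlgebra.ι ℂ V v) = algebraMap ℂ (Poly V) (φ v) :=
  extendDerivation_ι _ v

theorem euler_of_mem_polyDegree {d : ℕ} {b : Poly V} (hb : b ∈ polyDegree V d) :
    euler V b = (d : ℤ) • b := by
  induction d generalizing b with
  | zero =>
    rw [polyDegree, pow_zero, Submodule.mem_one] at hb
    obtain ⟨c, rfl⟩ := hb
    rw [euler_algebraMap]
    simp
  | succ d ih =>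
    rw [polyDegree, pow_succ] at hb
    induction hb using Submodule.mul_induction_on' with
    | mem_mul_mem a ha x hx =>
      obtain ⟨v, rfl⟩ := hx
      rw [euler_mul, euler_ι, ih ha, mul_smul_comm, mul_comm _ a]
      push_cast
      rw [add_smul, one_smul, add_comm]
    | add a _ b _ ha hb => rw [map_add, ha, hb, smul_add]

variable (V) in
theorem iSup_polyDegree : ⨆ d : ℕ, polyDegree V d = ⊤ := by
  rw [eq_top_iff]
  rintro b -
  induction b using SymmetricAlgebra.induction with
  | algebraMap c =>
    refine Submodule.mem_iSup_of_mem 0 ?_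
    rw [polyDegree, pow_zero]
    exact Submodule.algebraMap_mem c
  | ι x =>
    refine Submodule.mem_iSup_of_mem 1 ?_
    rw [polyDegree, pow_one]
    exact ⟨x, rfl⟩
  | add a b ha hb => exact add_mem ha hb
  | mul a b ha hb =>
    refine Submodule.iSup_induction
      (motive := fun a => a * b ∈ ⨆ d : ℕ, polyDegree V d) _ ha ?_ ?_ ?_
    · intro m a ha
      refine Submodule.iSup_induction
        (motive := fun b => a * b ∈ ⨆ d : ℕ, polyDegree V d) _ hb ?_ ?_ ?_
      · intro n b hb
        refine Submodule.mem_iSup_of_mem (m + n) ?_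
        rw [polyDegree, pow_add]
        exact Submodule.mul_mem_mul ha hb
      · rw [mul_zero]
        exact zero_mem _
      · intro x y hx hy
        rw [mul_add]
        exact add_mem hx hy
    · rw [zero_mul]
      exact zero_mem _
    · intro x y hx hy
      rw [add_mul]
      exact add_mem hx hy

/-- In any algebra of operators containing the Euler operator, the weight spaces of `S(V)` are its
homogeneous components. -/
theorem wt_eq_polyDegree {A : Type u} [Ring A] [Algebra ℂ A] [Module A (Poly V)]
    [IsScalarTower ℂ A (Poly V)] {nab : A} (h : ∀ b : Poly V, nab • b = euler V b) (d : ℕ) :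
    wt nab (Poly V) d = polyDegree V d := by
  have hle (d : ℕ) : polyDegree V d ≤ wt nab (Poly V) d := fun b hb => by
    rw [mem_wt, h, euler_of_mem_polyDegree hb]
  refine le_antisymm (fun b hb => ?_) (hle d)
  have := mem_of_mem_iSup_of_mem_wt nab
    (fun e => if 0 ≤ e then polyDegree V (Int.toNat e) else ⊥) (fun e => by
      split_ifs with he
      · simpa [Int.toNat_of_nonneg he] using hle (Int.toNat e)
      · exact bot_le) hb (by
      refine (show ⨆ d : ℕ, polyDegree V d ≤ _ from iSup_le fun d => ?_)
        (by rw [iSup_polyDegree]; trivial)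
      refine le_trans ?_ (le_iSup _ (d : ℤ))
      simp)
  simpa using this

theorem polyDegree_fg [FiniteDimensional ℂ V] (d : ℕ) : (polyDegree V d).FG :=
  (Module.Finite.iff_fg.1 (inferInstanceAs (Module.Finite ℂ
    (LinearMap.range (SymmetricAlgebra.ι ℂ V))))).pow d

end PolynomialWeights

/-! ### The Weyl algebra: grading, simplicity and density -/

section DiffOps

variable {V : Type u} [AddCommGroup V] [Module ℂ V]

theorem mulLeft_mem_diffOps (b : Poly V) : LinearMap.mulLeft ℂ b ∈ diffOps V := by
  induction b using SymmetricAlgebra.induction with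
  | algebraMap c =>
    convert (diffOps V).algebraMap_mem c using 1
    ext b
    simp [Algebra.smul_def]
  | ι x => exact Algebra.subset_adjoin (Or.inl ⟨x, rfl⟩)
  | mul a b ha hb =>
    rw [LinearMap.mulLeft_mul]
    exact mul_mem ha hb
  | add a b ha hb =>
    rw [show LinearMap.mulLeft ℂ (a + b) = LinearMap.mulLeft ℂ a + LinearMap.mulLeft ℂ b by
      ext; simp [add_mul]]
    exact add_mem ha hb

theorem constDerivation_mem_diffOps (φ : Module.Dual ℂ V) :
    (constDerivation φ).toLinearMap ∈ diffOps V :=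
  Algebra.subset_adjoin (Or.inr ⟨φ, rfl⟩)

theorem mulLeft_ι_mem_degPart (v : V) :
    LinearMap.mulLeft ℂ (SymmetricAlgebra.ι ℂ V v) ∈ degPart (euler V) 1 := by
  change euler V * _ - _ * euler V = _
  ext b
  simp [euler_mul, euler_ι, mul_comm]

theorem constDerivation_mem_degPart (φ : Module.Dual ℂ V) :
    (constDerivation φ).toLinearMap ∈ degPart (euler V) (-1) := by
  change euler V * _ - _ * euler V = _
  -- The commutator of two derivations is again a derivation, so it suffices to compare on `V`.
  have h : ⁅extendDerivation (SymmetricAlgebra.ι ℂ V), constDerivation φ⁆ = -constDerivation φ := by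
    refine derivation_ext fun v => ?_
    rw [Derivation.commutator_apply, constDerivation_ι, extendDerivation_ι, constDerivation_ι]
    simp [constDerivation_ι]
  ext b
  have := congrArg (fun d : Derivation ℂ (Poly V) (Poly V) => d b) h
  rw [Derivation.commutator_apply] at this
  simpa [euler] using this

/-- Every differential operator is a sum of homogeneous differential operators. -/
theorem mem_iSup_degPart_of_mem_diffOps {P : Module.End ℂ (Poly V)} (hP : P ∈ diffOps V) :
    P ∈ ⨆ n : ℤ, Subalgebra.toSubmodule (diffOps V) ⊓ degPart (euler V) n := by
  induction hP using Algebra.adjoin_induction with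
  | mem P hP =>
    rcases hP with ⟨v, rfl⟩ | ⟨φ, rfl⟩
    · exact Submodule.mem_iSup_of_mem 1 ⟨mulLeft_mem_diffOps _, mulLeft_ι_mem_degPart v⟩
    · exact Submodule.mem_iSup_of_mem (-1)
        ⟨constDerivation_mem_diffOps φ, constDerivation_mem_degPart φ⟩
  | algebraMap c =>
    exact Submodule.mem_iSup_of_mem 0 ⟨(diffOps V).algebraMap_mem c, algebraMap_mem_degPart c⟩
  | add P Q _ _ hP hQ => exact add_mem hP hQ
  | mul P Q _ _ hP hQ =>
    refine Submodule.iSup_induction (motive := fun P => P * Q ∈ ⨆ n : ℤ,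
      Subalgebra.toSubmodule (diffOps V) ⊓ degPart (euler V) n) _ hP ?_ ?_ ?_
    · intro m P hP
      refine Submodule.iSup_induction (motive := fun Q => P * Q ∈ ⨆ n : ℤ,
        Subalgebra.toSubmodule (diffOps V) ⊓ degPart (euler V) n) _ hQ ?_ ?_ ?_
      · intro n Q hQ
        exact Submodule.mem_iSup_of_mem (m + n)
          ⟨(diffOps V).mul_mem hP.1 hQ.1, mul_mem_degPart _ hP.2 hQ.2⟩
      · rw [mul_zero]
        exact zero_mem _
      · intro x y hx hy
        rw [mul_add]
        exact add_mem hx hy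
    · rw [zero_mul]
      exact zero_mem _
    · intro x y hx hy
      rw [add_mul]
      exact add_mem hx hy

theorem euler_eq_sum {ι : Type*} [Fintype ι] (e : Module.Basis ι ℂ V) (b : Poly V) :
    euler V b = ∑ i, SymmetricAlgebra.ι ℂ V (e i) * constDerivation (e.coord i) b := by
  induction b using SymmetricAlgebra.induction with
  | algebraMap c => simp [euler_algebraMap]
  | ι v =>
    rw [euler_ι]
    conv_lhs => rw [← e.sum_repr v]
    simp only [map_sum, map_smul, constDerivation_ι]
    refine Finset.sum_congr rfl fun i _ => ?_
    simp [Algebra.smul_def, mul_comm]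
  | mul a b ha hb =>
    rw [euler_mul, ha, hb, Finset.mul_sum, Finset.mul_sum, ← Finset.sum_add_distrib]
    refine Finset.sum_congr rfl fun i _ => ?_
    rw [Derivation.leibniz]
    simp only [smul_eq_mul]
    ring
  | add a b ha hb => simp [ha, hb, mul_add, Finset.sum_add_distrib]

variable [FiniteDimensional ℂ V]

theorem isGradedPair_diffOps :
    IsGradedPair (⟨euler V, euler_mem_diffOps⟩ : diffOps V) (Poly V) where
  iSup_degPart := by
    rw [eq_top_iff]
    rintro ⟨P, hP⟩ -
    have h : (⨆ n : ℤ, Subalgebra.toSubmodule (diffOps V) ⊓ degPart (euler V) n) ≤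
        (⨆ n, degPart (⟨euler V, euler_mem_diffOps⟩ : diffOps V) n).map
          (diffOps V).val.toLinearMap := by
      refine iSup_le fun n Q hQ => ⟨⟨Q, hQ.1⟩, Submodule.mem_iSup_of_mem n ?_, rfl⟩
      exact Subtype.ext hQ.2
    obtain ⟨Q, hQ, hQP⟩ := h (mem_iSup_degPart_of_mem_diffOps hP)
    rwa [← show Q = ⟨P, hP⟩ from Subtype.ext hQP]
  iSup_wt := by
    rw [← iSup_polyDegree]
    exact iSup_congr fun d => wt_eq_polyDegree (fun _ => rfl) d

/-- A polynomial with vanishing derivatives is constant. -/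
theorem exists_eq_algebraMap_of_constDerivation_eq_zero {b : Poly V}
    (h : ∀ φ : Module.Dual ℂ V, constDerivation φ b = 0) : ∃ c : ℂ, b = algebraMap ℂ _ c := by
  -- The formula `∇ = ∑ xᵢ ∂ᵢ` gives `∇ b = 0`, so `b` is homogeneous of degree zero.
  have h0 : b ∈ wt (⟨euler V, euler_mem_diffOps⟩ : diffOps V) (Poly V) (0 : ℕ) := by
    rw [mem_wt]
    change euler V b = _
    rw [euler_eq_sum (Module.finBasis ℂ V)]
    simp [h]
  rw [wt_eq_polyDegree (fun _ => rfl), polyDegree, pow_zero, Submodule.mem_one] at h0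
  obtain ⟨c, hc⟩ := h0
  exact ⟨c, hc.symm⟩

/-- `S(V)` is a simple module over the Weyl algebra. -/
instance isSimpleModule_diffOps : IsSimpleModule (diffOps V) (Poly V) where
  exists_pair_ne := ⟨⊥, ⊤, bot_ne_top⟩
  eq_bot_or_eq_top N := by
    refine or_iff_not_imp_left.2 fun hN => ?_
    obtain ⟨x, hxN, hx0, hx⟩ := isGradedPair_diffOps.exists_lowest N hN
    -- Constant derivations have degree `-1`, so they kill a lowest weight vector, which is thus a
    -- nonzero constant and generates everything by multiplication.
    obtain ⟨c, rfl⟩ := exists_eq_algebraMap_of_constDerivation_eq_zero (b := x) fun φ =>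
      hx ⟨_, constDerivation_mem_diffOps φ⟩
        (Submodule.mem_iSup_of_mem ⟨-1, by norm_num⟩
          (Subtype.ext (constDerivation_mem_degPart φ)))
    have hc : c ≠ 0 := by
      rintro rfl
      simp at hx0
    rw [eq_top_iff]
    rintro b -
    have := N.smul_mem ⟨_, mulLeft_mem_diffOps (c⁻¹ • b)⟩ hxN
    convert this using 1
    change b = (c⁻¹ • b) * algebraMap ℂ _ c
    rw [mul_comm, ← Algebra.smul_def, smul_smul, mul_inv_cancel₀ hc, one_smul]

/-- The Weyl algebra acts densely on `S(V)`. -/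
theorem exists_diffOps_eq_on (T : Poly V →ₗ[ℂ] Poly V) (s : Finset (Poly V)) :
    ∃ P ∈ diffOps V, ∀ b ∈ s, P b = T b := by
  -- An endomorphism commutes with multiplications, so it is determined by `f 1`; it commutes with
  -- derivations, which kill `1`, so `f 1` is constant.
  have hscalar (f : Module.End (diffOps V) (Poly V)) : ∃ c : ℂ, ∀ b, f b = c • b := by
    obtain ⟨c, hc⟩ := exists_eq_algebraMap_of_constDerivation_eq_zero (b := f 1) fun φ => by
      have := f.map_smul ⟨_, constDerivation_mem_diffOps φ⟩ 1
      change f (constDerivation φ 1) = constDerivation φ (f 1) at this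
      rw [← this, Derivation.map_one_eq_zero, map_zero]
    refine ⟨c, fun b => ?_⟩
    have := f.map_smul ⟨_, mulLeft_mem_diffOps b⟩ 1
    change f (b * 1) = b * f 1 at this
    rw [mul_one] at this
    rw [this, hc, Algebra.smul_def, mul_comm]
  -- Since the commutant consists of scalars, every `ℂ`-linear map lies in the bicommutant, to which
  -- the density theorem applies.
  let f : Module.End (Module.End (diffOps V) (Poly V)) (Poly V) :=
    { toFun := T
      map_add' := T.map_add
      map_smul' := fun f b => by
        obtain ⟨c, hc⟩ := hscalar f
        change T (f b) = f (T b)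
        rw [hc, hc, map_smul] }
  obtain ⟨P, hP⟩ := jacobson_density f s
  exact ⟨P, P.2, fun b hb => (hP b hb).symm⟩

end DiffOps

/-! ### Averaging operators over `G` -/

section Reynolds

variable {V : Type u} [AddCommGroup V] [Module ℂ V]

theorem act_ι (g : LinearMap.GeneralLinearGroup ℂ V) (v : V) :
    act g (SymmetricAlgebra.ι ℂ V v) = SymmetricAlgebra.ι ℂ V ((g : V →ₗ[ℂ] V) v) := by
  simp [act]

theorem act_mul (g h : LinearMap.GeneralLinearGroup ℂ V) (b : Poly V) :
    act (g * h) b = act g (act h b) := by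
  have key : act (g * h) = (act g).comp (act h) := by
    apply SymmetricAlgebra.algHom_ext
    ext v
    simp [act_ι]
  rw [key]
  rfl

theorem act_one (b : Poly V) : act (1 : LinearMap.GeneralLinearGroup ℂ V) b = b := by
  have key : act (1 : LinearMap.GeneralLinearGroup ℂ V) = AlgHom.id ℂ (Poly V) := by
    apply SymmetricAlgebra.algHom_ext
    ext v
    simp [act_ι]
  rw [key]
  rfl

theorem act_euler (g : LinearMap.GeneralLinearGroup ℂ V) (b : Poly V) :
    act g (euler V b) = euler V (act g b) := by
  induction b using SymmetricAlgebra.induction with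
  | algebraMap r => simp [euler_algebraMap]
  | ι x => simp [act_ι, euler_ι]
  | mul a b ha hb => simp [euler_mul, ha, hb]
  | add a b ha hb => simp [ha, hb]

theorem conjAct_apply (g : LinearMap.GeneralLinearGroup ℂ V) (P : Module.End ℂ (Poly V))
    (b : Poly V) : conjAct g P b = act g (P (act g⁻¹ b)) := rfl

/-- Conjugation by `g` permutes the generators: multiplication by `v` becomes multiplication by `g
v`, and `∂_φ` becomes `∂_{φ ∘ g⁻¹}`. -/
theorem conjAct_mem_diffOps (g : LinearMap.GeneralLinearGroup ℂ V)
    {P : Module.End ℂ (Poly V)} (hP : P ∈ diffOps V) : conjAct g P ∈ diffOps V := by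
  induction hP using Algebra.adjoin_induction with
  | mem P hP =>
    rcases hP with ⟨v, rfl⟩ | ⟨φ, rfl⟩
    · convert mulLeft_mem_diffOps (act g (SymmetricAlgebra.ι ℂ V v)) using 1
      ext b
      simp [conjAct_apply, act_mul_inv]
    · convert constDerivation_mem_diffOps (φ ∘ₗ ((g⁻¹ : LinearMap.GeneralLinearGroup ℂ V) :
        V →ₗ[ℂ] V)) using 1
      ext b
      rw [conjAct_apply]
      change act g (constDerivation φ (act g⁻¹ b)) = constDerivation _ b
      induction b using SymmetricAlgebra.induction with
      | algebraMap r => simp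
      | ι x => simp [act_ι, constDerivation_ι]
      | mul a b ha hb => simp [ha, hb, act_mul_inv]
      | add a b ha hb => simp [ha, hb]
  | algebraMap c =>
    convert (diffOps V).algebraMap_mem c using 1
    ext b
    simp [conjAct_apply, Module.algebraMap_end_apply, act_mul_inv]
  | add P Q _ _ hP hQ =>
    convert add_mem hP hQ using 1
    ext b
    simp [conjAct_apply]
  | mul P Q _ _ hP hQ =>
    convert mul_mem hP hQ using 1
    ext b
    simp [conjAct_apply, act_mul_inv]

variable (G : Subgroup (LinearMap.GeneralLinearGroup ℂ V)) [Finite G]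

/-- The average of an operator over the finite group `G`. -/
def reynolds : Module.End ℂ (Poly V) →ₗ[ℂ] Module.End ℂ (Poly V) where
  toFun P := (Nat.card G : ℂ)⁻¹ • ∑ᶠ g : G, conjAct (g : LinearMap.GeneralLinearGroup ℂ V) P
  map_add' P Q := by
    have := Fintype.ofFinite G
    simp only [finsum_eq_sum_of_fintype]
    ext b
    simp [conjAct_apply, Finset.sum_add_distrib]
  map_smul' c P := by
    have := Fintype.ofFinite G
    simp only [finsum_eq_sum_of_fintype]
    ext b
    simp [conjAct_apply, Finset.smul_sum, smul_comm c]

theorem reynolds_apply [Fintype G] (P : Module.End ℂ (Poly V)) (b : Poly V) :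
    reynolds G P b = (Nat.card G : ℂ)⁻¹ •
      ∑ g : G, act (g : LinearMap.GeneralLinearGroup ℂ V)
        (P (act (g : LinearMap.GeneralLinearGroup ℂ V)⁻¹ b)) := by
  change ((Nat.card G : ℂ)⁻¹ • ∑ᶠ g : G, conjAct (g : LinearMap.GeneralLinearGroup ℂ V) P) b = _
  rw [finsum_eq_sum_of_fintype]
  simp [conjAct_apply]

variable {G}

theorem average_const (b : Poly V) [Fintype G] :
    (Nat.card G : ℂ)⁻¹ • ∑ _g : G, b = b := by
  rw [Finset.sum_const, Finset.card_univ, ← Nat.card_eq_fintype_card, ← Nat.cast_smul_eq_nsmul ℂ,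
    smul_smul, inv_mul_cancel₀ (Nat.cast_ne_zero.2 Nat.card_pos.ne'), one_smul]

/-- If `P` agrees with a `G`-equivariant map on the orbit of `b` then so does its average. -/
theorem reynolds_apply_eq (T : Poly V → Poly V)
    (hT : ∀ g ∈ G, ∀ b, act g (T b) = T (act g b)) (P : Module.End ℂ (Poly V)) (b : Poly V)
    (h : ∀ g ∈ G, P (act g b) = T (act g b)) : reynolds G P b = T b := by
  have := Fintype.ofFinite G
  rw [reynolds_apply]
  conv_rhs => rw [← average_const (G := G) (T b)]
  congr 1
  refine Finset.sum_congr rfl fun g _ => ?_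
  rw [h _ (inv_mem g.2), hT _ g.2, act_mul_inv _ _ (mul_inv_cancel _)]

theorem reynolds_mem_invDiffOps {P : Module.End ℂ (Poly V)} (hP : P ∈ diffOps V) :
    reynolds G P ∈ invDiffOps G := by
  have := Fintype.ofFinite G
  constructor
  · refine Subalgebra.smul_mem _ ?_ _
    rw [finsum_eq_sum_of_fintype]
    exact sum_mem fun g _ => conjAct_mem_diffOps _ hP
  · intro h hh
    rw [conjAct_eq_iff]
    intro b
    rw [reynolds_apply, reynolds_apply, map_smul, map_sum]
    congr 1
    -- Reindexing `g` as `h g` absorbs the extra factor, because `(h g)⁻¹ h = g⁻¹`.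
    refine Fintype.sum_equiv (Equiv.mulLeft ⟨h, hh⟩) _ _ fun g => ?_
    rw [Equiv.coe_mulLeft, Subgroup.coe_mul, act_mul, ← act_mul _ h]
    congr 4
    group

theorem reynolds_mem_degPart {n : ℤ} {P : Module.End ℂ (Poly V)} (hP : P ∈ degPart (euler V) n) :
    reynolds G P ∈ degPart (euler V) n := by
  have := Fintype.ofFinite G
  have hP' : euler V * P - P * euler V = n • P := hP
  refine Submodule.smul_mem _ _ ?_
  rw [finsum_eq_sum_of_fintype]
  refine sum_mem fun g _ => ?_
  change euler V * _ - _ * euler V = _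
  ext b
  have := LinearMap.congr_fun hP' (act (g : LinearMap.GeneralLinearGroup ℂ V)⁻¹ b)
  simp only [LinearMap.sub_apply, Module.End.mul_apply, LinearMap.smul_apply, ← act_euler] at this
  simp only [LinearMap.sub_apply, Module.End.mul_apply, LinearMap.smul_apply, conjAct_apply,
    ← act_euler, ← map_sub, this, map_zsmul]

theorem reynolds_of_mem {P : Module.End ℂ (Poly V)} (hP : P ∈ invDiffOps G) :
    reynolds G P = P := by
  ext b
  exact reynolds_apply_eq P (fun g hg => (conjAct_eq_iff g P).1 (hP.2 g hg)) P b fun _ _ => rfl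

/-- Every `G`-equivariant linear endomorphism of `S(V)` agrees at each given polynomial with an
invariant differential operator. -/
theorem exists_smul_eq_of_equivariant [FiniteDimensional ℂ V] (T : Poly V →ₗ[ℂ] Poly V)
    (hT : ∀ g ∈ G, ∀ b, act g (T b) = T (act g b)) (b : Poly V) : ∃ P : D G, P • b = T b := by
  classical
  have := Fintype.ofFinite G
  -- Averaging at `b` evaluates `P` on the whole orbit of `b`; this orbit is finite, so density can
  -- control all these values at once.
  obtain ⟨P, hP, h⟩ := exists_diffOps_eq_on T
    (Finset.univ.image fun g : G => act (g : LinearMap.GeneralLinearGroup ℂ V) b)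
  refine ⟨⟨reynolds G P, reynolds_mem_invDiffOps hP⟩, ?_⟩
  exact reynolds_apply_eq T hT P b fun g hg => h _ (Finset.mem_image.2 ⟨⟨g, hg⟩, by simp⟩)

/-- The inclusion of `D` into the operators on `S(V)`, as a linear map. -/
def toEnd (G : Subgroup (LinearMap.GeneralLinearGroup ℂ V)) : D G →ₗ[ℂ] Module.End ℂ (Poly V) where
  toFun P := P.1
  map_add' _ _ := rfl
  map_smul' _ _ := rfl

/-- Averaging preserves the degree of an operator and fixes invariant ones, so the homogeneous
decomposition in the Weyl algebra averages to one inside `D`. -/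
theorem isGradedPair_D [FiniteDimensional ℂ V] : IsGradedPair (nabla G) (Poly V) where
  iSup_degPart := by
    rw [eq_top_iff]
    rintro ⟨P, hP⟩ -
    have h : (⨆ n : ℤ, Subalgebra.toSubmodule (diffOps V) ⊓ degPart (euler V) n) ≤
        ((⨆ n, degPart (nabla G) n).map (toEnd G)).comap (reynolds G) := by
      refine iSup_le fun n Q hQ => ⟨⟨reynolds G Q, reynolds_mem_invDiffOps hQ.1⟩,
        Submodule.mem_iSup_of_mem n ?_, rfl⟩
      exact Subtype.ext (reynolds_mem_degPart hQ.2)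
    obtain ⟨Q, hQ, hQP⟩ := h (mem_iSup_degPart_of_mem_diffOps hP.1)
    rw [reynolds_of_mem hP] at hQP
    rwa [← show Q = ⟨P, hP⟩ from Subtype.ext hQP]
  iSup_wt := by
    rw [← iSup_polyDegree]
    exact iSup_congr fun d => wt_eq_polyDegree (fun _ => rfl) d

end Reynolds


/-! ### Semisimplicity of `S(V)` over `D` -/

section Semisimple

variable {V : Type u} [AddCommGroup V] [Module ℂ V]
variable (G : Subgroup (LinearMap.GeneralLinearGroup ℂ V))

/-- The representation of `G` on `S(V)`. -/
def polyRep : Representation ℂ G (Poly V) where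
  toFun g := (act (g : LinearMap.GeneralLinearGroup ℂ V)).toLinearMap
  map_one' := LinearMap.ext fun b => act_one b
  map_mul' _ _ := LinearMap.ext fun b => act_mul _ _ b

variable {G}

theorem single_smul_polyRep (g : G) (x : (polyRep G).asModule) :
    (polyRep G).asModuleEquiv (MonoidAlgebra.single g (1 : ℂ) • x) =
      act (g : LinearMap.GeneralLinearGroup ℂ V) ((polyRep G).asModuleEquiv x) := by
  rw [Representation.single_smul, one_smul]
  rfl

/-- An invariant differential operator, as an endomorphism of the representation `S(V)`. -/
def toModuleEnd (P : D G) : Module.End (MonoidAlgebra ℂ G) (polyRep G).asModule :=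
  MonoidAlgebra.equivariantOfLinearOfComm
    ((polyRep G).asModuleEquiv.symm.toLinearMap ∘ₗ toEnd G P ∘ₗ
      (polyRep G).asModuleEquiv.toLinearMap) fun g x => by
    apply (polyRep G).asModuleEquiv.injective
    rw [single_smul_polyRep]
    change P.1 ((polyRep G).asModuleEquiv (MonoidAlgebra.single g (1 : ℂ) • x)) = act _ (P.1 _)
    rw [single_smul_polyRep]
    exact ((conjAct_eq_iff _ _).1 (P.2.2 g g.2) _).symm

theorem toModuleEnd_apply (P : D G) (x : (polyRep G).asModule) :
    (polyRep G).asModuleEquiv (toModuleEnd P x) = P • (polyRep G).asModuleEquiv x := rfl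

variable [Finite G] [FiniteDimensional ℂ V]

theorem exists_smul_eq_moduleEnd (f : Module.End (MonoidAlgebra ℂ G) (polyRep G).asModule)
    (x : (polyRep G).asModule) :
    ∃ P : D G, P • (polyRep G).asModuleEquiv x = (polyRep G).asModuleEquiv (f x) := by
  refine exists_smul_eq_of_equivariant ((polyRep G).asModuleEquiv.toLinearMap ∘ₗ
    f.restrictScalars ℂ ∘ₗ (polyRep G).asModuleEquiv.symm.toLinearMap) ?_
    ((polyRep G).asModuleEquiv x)
  intro g hg b
  obtain ⟨y, rfl⟩ := (polyRep G).asModuleEquiv.surjective b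
  have := congrArg (polyRep G).asModuleEquiv
    (f.map_smul (MonoidAlgebra.single (⟨g, hg⟩ : G) (1 : ℂ)) y)
  rw [single_smul_polyRep] at this
  rw [← single_smul_polyRep ⟨g, hg⟩ y]
  exact this.symm

/-- If `P b ≠ 0`, then `P` is injective on `S` by Schur's lemma, and complete reducibility provides
an equivariant `f` on `S(V)` undoing it on `S`. Some `Q` in `D` agrees with `f` at `P b`, so `Q P b
= b` and every nonzero submodule of `D b` contains `b`. -/
theorem isSimpleModule_span_singleton (S : Submodule (MonoidAlgebra ℂ G) (polyRep G).asModule)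
    [IsSimpleModule (MonoidAlgebra ℂ G) S] (s : S) (hs : s ≠ 0) :
    IsSimpleModule (D G)
      (Submodule.span (D G) {(polyRep G).asModuleEquiv (s : (polyRep G).asModule)}) := by
  set b := (polyRep G).asModuleEquiv (s : (polyRep G).asModule) with hb
  have hb0 : b ≠ 0 := fun h => hs (Subtype.ext ((polyRep G).asModuleEquiv.map_eq_zero_iff.1 h))
  rw [isSimpleModule_iff_isAtom]
  refine ⟨fun h => hb0 (Submodule.span_singleton_eq_bot.1 h), fun N hN => ?_⟩
  by_contra hN0
  obtain ⟨x, hx, hx0⟩ := N.exists_mem_ne_zero_of_ne_bot hN0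
  obtain ⟨P, rfl⟩ := Submodule.mem_span_singleton.1 (hN.le hx)
  have hne : toModuleEnd P ∘ₗ S.subtype ≠ 0 := fun h => hx0 <| by
    rw [hb, ← toModuleEnd_apply]
    exact congrArg (polyRep G).asModuleEquiv (LinearMap.congr_fun h s)
  obtain ⟨f, hf⟩ := IsSemisimpleModule.extension_property (toModuleEnd P ∘ₗ S.subtype)
    (LinearMap.injective_of_ne_zero hne) S.subtype
  obtain ⟨Q, hQ⟩ := exists_smul_eq_moduleEnd f (toModuleEnd P s)
  refine hN.not_ge ?_
  rw [Submodule.span_singleton_le_iff_mem]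
  have hfb : f (toModuleEnd P s) = s := LinearMap.congr_fun hf s
  rw [hfb, toModuleEnd_apply] at hQ
  rw [hb, ← hQ]
  exact N.smul_mem Q hx

/-- `S(V)` is a semisimple module over the invariant differential operators. -/
theorem isSemisimpleModule_D : IsSemisimpleModule (D G) (Poly V) := by
  refine IsSemisimpleModule.of_sSup_simples_eq_top (eq_top_iff.2 ?_)
  rintro b -
  obtain ⟨x, rfl⟩ := (polyRep G).asModuleEquiv.surjective b
  have hx : x ∈ sSup {S : Submodule (MonoidAlgebra ℂ G) (polyRep G).asModule |
      IsSimpleModule (MonoidAlgebra ℂ G) S} := by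
    rw [IsSemisimpleModule.sSup_simples_eq_top]
    trivial
  rw [sSup_eq_iSup'] at hx
  refine Submodule.iSup_induction (motive := fun x => (polyRep G).asModuleEquiv x ∈
    sSup {N : Submodule (D G) (Poly V) | IsSimpleModule (D G) N}) _ hx ?_ ?_ ?_
  · rintro ⟨S, hS⟩ s hs
    have : IsSimpleModule (MonoidAlgebra ℂ G) S := hS
    by_cases hs0 : (⟨s, hs⟩ : S) = 0
    · rw [show s = 0 from congrArg Subtype.val hs0, map_zero]
      exact zero_mem _
    · exact (le_sSup (isSimpleModule_span_singleton S ⟨s, hs⟩ hs0) :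
        Submodule.span (D G) _ ≤ sSup _) (Submodule.mem_span_singleton_self _)
  · rw [map_zero]
    exact zero_mem _
  · intro x y hx hy
    rw [map_add]
    exact add_mem hx hy

end Semisimple

/-! ### Finite generation and finite-dimensionality -/

section Finiteness

variable {V : Type u} [AddCommGroup V] [Module ℂ V]
variable (G : Subgroup (LinearMap.GeneralLinearGroup ℂ V))

/-- The action of `G` on `S(V)` by ring automorphisms. -/
@[reducible]
def polyAction : MulSemiringAction G (Poly V) where
  smul g b := act (g : LinearMap.GeneralLinearGroup ℂ V) b
  one_smul b := act_one b
  mul_smul _ _ b := act_mul _ _ b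
  smul_zero g := map_zero (act (g : LinearMap.GeneralLinearGroup ℂ V))
  smul_add g := map_add (act (g : LinearMap.GeneralLinearGroup ℂ V))
  smul_one g := map_one (act (g : LinearMap.GeneralLinearGroup ℂ V))
  smul_mul g := map_mul (act (g : LinearMap.GeneralLinearGroup ℂ V))

/-- The algebra of invariant polynomials. -/
def invPoly : Subalgebra ℂ (Poly V) where
  carrier := {b | ∀ g ∈ G, act g b = b}
  mul_mem' ha hb g hg := by rw [map_mul, ha g hg, hb g hg]
  add_mem' ha hb g hg := by rw [map_add, ha g hg, hb g hg]
  algebraMap_mem' c g _ := AlgHom.commutes _ c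

/-- `S(V)` is integral over the invariants of a finite group, and it is a finitely generated
algebra, hence a finite module over them. -/
theorem finite_invPoly [Finite G] [FiniteDimensional ℂ V] :
    Module.Finite (invPoly G) (Poly V) := by
  let := polyAction G
  have : Algebra.IsInvariant (invPoly G) (Poly V) G :=
    ⟨fun b hb => ⟨⟨b, fun g hg => hb ⟨g, hg⟩⟩, rfl⟩⟩
  have : Algebra.IsIntegral (invPoly G) (Poly V) := Algebra.IsInvariant.isIntegral _ _ G
  have : Algebra.FiniteType ℂ (Poly V) := .equiv inferInstance
    (SymmetricAlgebra.equivMvPolynomial (Module.finBasis ℂ V)).symm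
  have : Algebra.FiniteType (invPoly G) (Poly V) := .of_restrictScalars_finiteType ℂ _ _
  exact Algebra.IsIntegral.finite

theorem mulLeft_mem_invDiffOps {b : Poly V} (hb : b ∈ invPoly G) :
    LinearMap.mulLeft ℂ b ∈ invDiffOps G :=
  ⟨mulLeft_mem_diffOps b, fun g hg => (conjAct_eq_iff g _).2 fun c => by simp [hb g hg]⟩

theorem finite_D [Finite G] [FiniteDimensional ℂ V] : Module.Finite (D G) (Poly V) := by
  obtain ⟨s, hs⟩ := (finite_invPoly G).fg_top
  refine ⟨s, eq_top_iff.2 ?_⟩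
  rintro b -
  have hb : b ∈ Submodule.span (invPoly G) (s : Set (Poly V)) := by rw [hs]; trivial
  induction hb using Submodule.span_induction with
  | mem x hx => exact Submodule.subset_span hx
  | zero => exact zero_mem _
  | add x y _ _ hx hy => exact add_mem hx hy
  | smul a x _ hx => exact Submodule.smul_mem _ ⟨_, mulLeft_mem_invDiffOps G a.2⟩ hx

variable [Finite G] [FiniteDimensional ℂ V]

/-- The lowest weight vectors lie in finitely many degrees. -/
theorem exists_Bann_le : ∃ m : ℕ, ∀ b : Bann G, (b : Poly V) ∈ ⨆ d : Fin m, polyDegree V d := by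
  have := isSemisimpleModule_D (G := G)
  have := finite_D G
  have H := isGradedPair_D (G := G)
  -- The part of `B^ann` in degrees below `m` is an `R`-submodule because `D⁰` preserves degrees.
  let F : ℕ →o Submodule (RG G) (Bann G) :=
    { toFun := fun m =>
        { carrier := {b | (b : Poly V) ∈ ⨆ d : Fin m, polyDegree V d}
          add_mem' := fun ha hb => (⨆ d : Fin m, polyDegree V d).add_mem ha hb
          zero_mem' := zero_mem (⨆ d : Fin m, polyDegree V d)
          smul_mem' := by
            intro r b hb
            obtain ⟨a, rfl⟩ := Ideal.Quotient.mk_surjective r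
            change (a : D G) • (b : Poly V) ∈ ⨆ d : Fin m, polyDegree V d
            refine Submodule.iSup_induction (motive := fun b =>
              (a : D G) • b ∈ ⨆ d : Fin m, polyDegree V d) _ hb ?_ ?_ ?_
            · intro d b hb
              refine Submodule.mem_iSup_of_mem d ?_
              rw [← wt_eq_polyDegree (nab := nabla G) fun _ => rfl] at hb ⊢
              simpa using smul_mem_wt (nabla G) (show (a : D G) ∈ degPart _ 0 from a.2) hb
            · rw [smul_zero]
              exact zero_mem _
            · intro x y hx hy
              rw [smul_add]
              exact add_mem hx hy }
      monotone' := fun m n hmn b hb =>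
        (iSup_le fun d : Fin m => le_iSup (fun d : Fin n => polyDegree V d) (d.castLE hmn) :
          ⨆ d : Fin m, polyDegree V d ≤ _) hb }
  -- `S(V)` is semisimple and finitely generated over `D`, hence Noetherian; the chain is carried
  -- there by the lattice isomorphism, and injectivity brings the stabilisation back to `B^ann`.
  obtain ⟨m, hm⟩ := monotone_stabilizes_iff_noetherian.2
    (inferInstance : IsNoetherian (D G) (Poly V))
    ((annIso H).symm.toOrderEmbedding.toOrderHom.comp F)
  have hm' : ∀ n, m ≤ n → F m = F n := fun n hn => (annIso H).symm.injective (hm n hn)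
  refine ⟨m, fun b => ?_⟩
  have hb : ∃ n, b ∈ F n := by
    have h : (b : Poly V) ∈ ⨆ d : ℕ, polyDegree V d := by rw [iSup_polyDegree]; trivial
    rw [Submodule.mem_iSup_iff_exists_finset] at h
    obtain ⟨s, hs⟩ := h
    refine ⟨s.sup id + 1, ?_⟩
    change (b : Poly V) ∈ ⨆ d : Fin (s.sup id + 1), polyDegree V d
    refine (show ⨆ d ∈ s, polyDegree V d ≤ _ from iSup₂_le fun d hd => ?_) hs
    exact le_iSup (fun d : Fin (s.sup id + 1) => polyDegree V d)
      ⟨d, Nat.lt_succ_of_le (Finset.le_sup (f := id) hd)⟩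
  obtain ⟨n, hn⟩ := hb
  have h1 : b ∈ F (max m n) := F.monotone (le_max_right m n) hn
  rw [← hm' _ (le_max_left m n)] at h1
  exact h1

theorem finiteDimensional_Bann : FiniteDimensional ℂ (Bann G) := by
  obtain ⟨m, hm⟩ := exists_Bann_le G
  have hfin (d : ℕ) : FiniteDimensional ℂ (polyDegree V d) := Module.Finite.iff_fg.2 (polyDegree_fg d)
  have : FiniteDimensional ℂ (⨆ d : Fin m, polyDegree V d : Submodule ℂ (Poly V)) := inferInstance
  let f : Bann G →ₗ[ℂ] (⨆ d : Fin m, polyDegree V d : Submodule ℂ (Poly V)) :=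
    { toFun := fun b => ⟨b, hm b⟩
      map_add' := fun _ _ => rfl
      map_smul' := fun _ _ => rfl }
  exact FiniteDimensional.of_injective f fun a b h =>
    Subtype.ext (congrArg (fun x : (⨆ d : Fin m, polyDegree V d : Submodule ℂ (Poly V)) =>
      (x : Poly V)) h)

end Finiteness

end InvDiff

end

theorem corollary3p4 {V : Type*} [AddCommGroup V] [Module ℂ V] [FiniteDimensional ℂ V]
    (G : Subgroup (LinearMap.GeneralLinearGroup ℂ V)) [Finite G] :
    -- (1) `B^ann` is finite-dimensional and semisimple over `R`
    (FiniteDimensional ℂ (InvDiff.Bann G) ∧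
      IsSemisimpleModule (InvDiff.RG G) (InvDiff.Bann G)) ∧
    -- (2) `N ↦ N^ann` is an isomorphism of categories, with inverse given by `W ↦ D W`
    (∃ δ : InvDiff.ModSub (InvDiff.RG G) (InvDiff.Bann G) ⥤
          InvDiff.ModSub (InvDiff.D G) (InvDiff.Poly V),
      (∀ W : Submodule (InvDiff.RG G) (InvDiff.Bann G), δ.obj W = InvDiff.gen (InvDiff.nabla G) W) ∧
      InvDiff.annFunctor (InvDiff.nabla G) (InvDiff.Poly V) ⋙ δ = CategoryTheory.Functor.id _ ∧
      δ ⋙ InvDiff.annFunctor (InvDiff.nabla G) (InvDiff.Poly V) = CategoryTheory.Functor.id _) ∧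
    -- (3) simple submodules correspond to simple submodules
    ((∀ N : Submodule (InvDiff.D G) (InvDiff.Poly V),
        IsSimpleModule (InvDiff.D G) N ↔ IsSimpleModule (InvDiff.RG G) (InvDiff.ann (InvDiff.nabla G) N)) ∧
      (∀ W : Submodule (InvDiff.RG G) (InvDiff.Bann G),
        IsSimpleModule (InvDiff.RG G) W ↔ IsSimpleModule (InvDiff.D G) (InvDiff.gen (InvDiff.nabla G) W))) ∧
    -- (4) each simple `R`-submodule of `B^ann` lies in a single degree
    (∀ W : Submodule (InvDiff.RG G) (InvDiff.Bann G), IsSimpleModule (InvDiff.RG G) W →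
      ∃ d : ℕ, ∀ b ∈ W, (b : InvDiff.Poly V) ∈ InvDiff.polyDegree V d) := by
  have hss := InvDiff.isSemisimpleModule_D (G := G)
  have H := InvDiff.isGradedPair_D (G := G)
  refine ⟨⟨InvDiff.finiteDimensional_Bann G, InvDiff.isSemisimpleModule_Mann H⟩,
    InvDiff.exists_inverse_annFunctor H,
    ⟨fun N => (InvDiff.isSimpleModule_ann_iff H N).symm, fun W => ?_⟩, fun W hW => ?_⟩
  · rw [← InvDiff.isSimpleModule_ann_iff H, InvDiff.ann_gen H]
  · obtain ⟨d, hd⟩ := H.exists_weight_of_isSimpleModule W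
    refine ⟨d, fun b hb => ?_⟩
    rw [← InvDiff.wt_eq_polyDegree (nab := InvDiff.nabla G) fun _ => rfl]
    exact hd b hb
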